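/- **Protocols.** Let $\gamma,\varepsilon>0$. A deterministic $R$-round $(\gamma,\varepsilon)$-MPC protocol $\pi$ works on inputs of $N$ words, where a word is an element of $\mathbb Z_{2^p}$ with $p=\Theta(\log N)$, with $P=\Theta(N^{1+\gamma-\varepsilon})$ machines, each with a local memory of $s=O(N^{\varepsilon})$ words. Initially the input words are distributed, in an arbitrary fixed way and at most $s$ per machine, over the first $\lceil N/s\rceil$ machines. In each round every machine prepares, by an arbitrary function of its local memory (depending on the machine and the round), messages for the other machines of at most $s$ words in total, and data that it keeps. After the round its local memory consists of the messages it received, tagged with their senders, and the data it kept; for every input this is at most $s$ words. After round $R$ the output $\pi(x)\in\mathbb Z_{2^p}^N$ is stored in the first $\lceil N/s\rceil$ machines, at most $s$ output words per machine, each output word being a fixed function of the final memory of its machine. **ANNA-transformers.** An ANNA head with parameters $r,c,\ell\ge 0$ and failure probability $0$ consists of functions $Q,K,V:\mathbb R^d\to\mathbb R^m$ and, for each $X\in\mathbb R^{N\times d}$ with rows $X_i$, of weights $w_{i,j}\ge 0$ with $\sum_j w_{i,j}=1$. With $q_i=Q(X_i)$, $k_j=K(X_j)$, $v_j=V(X_j)$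 and $\mathcal N(q,t)=\{j:\|q-k_j\|\le t\}$, the weights satisfy, for all $i,j$, $$w_{i,j}>0\Rightarrow j\in\mathcal N(q_i,cr),\qquad j\in\mathcal N(q_i,r)\Rightarrow w_{i,j}\ge \frac1{(|\mathcal N(q_i,cr)|-1)\ell+1}.$$ Its output $A(X)\in\mathbb R^{N\times m}$ has rows $\sum_j w_{i,j}v_j$. The head is an exact match attention (EMA) head if $w_{i,j}=1/|\{j':k_{j'}=q_i\}|$ when $k_j=q_i$, and $w_{i,j}=0$ otherwise. A layer with $H$ heads computes $X\mapsto\sum_{h=1}^H A_h(X)W_h$ with $W_h\in\mathbb R^{m\times d}$. A transformer with $L$ layers applies the layers one after the other and then a function $\psi:\mathbb R^d\to\mathbb R^d$ to each row. It has precision $b$ if all $Q,K,V,\psi$ depend only on the coordinates of their argument rounded (with saturation) to multiples of $2^{-b}$ in $[-2^b,2^b]$ and have such numbers as coordinates of their values, and the entries of all $W_h$ are such numbers. On input $x\in\mathbb Z_{2^p}^N$ the $i$-th row of the input matrix is $(x_i,i,0,\dots,0)$, and $T(x)_i$ is the first coordinate of the $i$-th output row; words are identified with $0,\dots,2^p-1$,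 and positions are $i=0,\dots,N-1$. **Theorem.** Fix constants $0<\varepsilon<\varepsilon'<1$. Then for every $N\ge 1$, every $R\ge1$, every deterministic $R$-round $(\varepsilon,\varepsilon)$-MPC protocol $\pi$ on inputs of $N$ words, and all $c>1$, $\ell\ge 1$, there is an ANNA-transformer $T$ with context length $N$ and parameters $r=0$, $c$, $\ell$ and failure probability $0$, all of whose heads are EMA heads, with $O(R)$ layers, $O(N^{(\varepsilon'-\varepsilon)/4})$ heads per layer, embedding dimension $m=O(N^{\varepsilon'})$, token dimension $d=O(N^{\varepsilon'})$ and precision $b=O(\log N)$, such that $$T(x)=\pi(x)\quad\text{for all }x\in\mathbb Z_{2^p}^N.$$ The constants hidden in the bounds on $T$ depend only on $\varepsilon$, $\varepsilon'$ and the constants hidden in $p=\Theta(\log N)$, $P=\Theta(N)$, $s=O(N^{\varepsilon})$. -/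

import Mathlib

/-! ### Massively parallel computation -/

/-- A word of `p` bits, an element of `ℤ_{2^p}`. -/
abbrev Word (p : ℕ) : Type := ZMod (2 ^ p)

/-- The content of the local memory of one machine: for each of the `P` machines, the message
(a list of words, empty when there is none) that was last received from that machine. The entry of
a machine in its own memory holds the data which the machine keeps for itself. -/
abbrev LocalMem (P p : ℕ) : Type := Fin P → List (Word p)

/-- The number of words in a local memory. -/
def LocalMem.size {P p : ℕ} (M : LocalMem P p) : ℕ := ∑ k, (M k).length

/-- The data of a deterministic protocol on inputs of `N` words with `P` machines: where each input
word is placed, the (arbitrary) local computation of each machine in each round, and where and how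
each output word is found in the end. -/
structure MPCProgram (N p P : ℕ) where
  /-- the machine that initially stores the `j`-th input word -/
  inLoc : Fin N → Fin P
  /-- `send t i M k` is the message that machine `i` with local memory `M` prepares in round `t` for
  machine `k`; for `k = i` it is the data that machine `i` keeps -/
  send : ℕ → Fin P → LocalMem P p → LocalMem P p
  /-- the machine that finally stores the `j`-th output word -/
  outLoc : Fin N → Fin P
  /-- the `j`-th output word, as stored in the final local memory of machine `outLoc j` -/
  read : Fin N → LocalMem P p → Word p

namespace MPCProgram

variable {N p P : ℕ}

/-- `π.mem x t i` is the local memory of machine `i` after `t` rounds on input `x`. Initially it holds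
the input words assigned to the machine, in the order of their indices. -/
def mem (π : MPCProgram N p P) (x : Fin N → Word p) : ℕ → Fin P → LocalMem P p
  | 0 => fun i k =>
      if k = i then ((List.finRange N).filter (fun j => π.inLoc j = i)).map x else []
  | t + 1 => fun i k => π.send t k (π.mem x t k) i

end MPCProgram

/-- A deterministic `R`-round protocol for `P` machines with local memories of `s` words of `p` bits,
on inputs of `N` words. -/
structure MPCProtocol (N p P s R : ℕ) extends MPCProgram N p P where
  /-- the input is distributed over the first `⌈N / s⌉` machines -/
  inLoc_lt : ∀ j, (inLoc j : ℕ) < N ⌈/⌉ s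
  /-- the input words given to a machine fit into its memory -/
  inLoc_card : ∀ i, (Finset.univ.filter (fun j => inLoc j = i)).card ≤ s
  /-- in each round, the messages that a machine prepares for other machines have at most `s` words
  in total -/
  sent_le : ∀ x, ∀ t < R, ∀ i,
    ∑ k ∈ Finset.univ.erase i, (send t i (toMPCProgram.mem x t i) k).length ≤ s
  /-- at the end of each round, the messages that a machine has received, together with the data
  that it has kept, have at most `s` words in total -/
  received_le : ∀ x, ∀ t < R, ∀ i, (toMPCProgram.mem x (t + 1) i).size ≤ s
  /-- the output is stored in the first `⌈N / s⌉` machines -/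
  outLoc_lt : ∀ j, (outLoc j : ℕ) < N ⌈/⌉ s
  /-- the output words stored in a machine fit into its memory -/
  outLoc_card : ∀ i, (Finset.univ.filter (fun j => outLoc j = i)).card ≤ s

/-- The output `π(x)` of the protocol, read after the `R`-th round. -/
def MPCProtocol.output {N p P s R : ℕ} (π : MPCProtocol N p P s R) (x : Fin N → Word p) :
    Fin N → Word p :=
  fun j => π.read j (π.toMPCProgram.mem x R (π.outLoc j))

/-- The size restrictions of a `(γ, ε)`-MPC protocol on inputs of `N` words, with `κ` in place of all
the constants hidden by the asymptotic notation:
`p = Θ(log N)`, `P = Θ(N^(1 + γ - ε))` and `s = O(N^ε)`. -/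
structure MPCSizes (γ ε κ : ℝ) (N p P s : ℕ) : Prop where
  word_le : (p : ℝ) ≤ κ * Real.log N
  le_word : Real.log N ≤ κ * p
  machines_le : (P : ℝ) ≤ κ * (N : ℝ) ^ (1 + γ - ε)
  le_machines : (N : ℝ) ^ (1 + γ - ε) ≤ κ * P
  memory_le : (s : ℝ) ≤ κ * (N : ℝ) ^ ε

/-! ### Approximate nearest neighbor attention -/

/-- A real `N × d` matrix, given by its rows (the tokens). -/
abbrev Rows (N d : ℕ) : Type := Fin N → Fin d → ℝ

open Classical in
/-- The (indices of the) keys within distance `t` of the query `q`. -/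
noncomputable def keysNear {N m : ℕ} (q : EuclideanSpace ℝ (Fin m))
    (k : Fin N → EuclideanSpace ℝ (Fin m)) (t : ℝ) : Finset (Fin N) :=
  Finset.univ.filter (fun j => ‖q - k j‖ ≤ t)

/-- An approximate nearest neighbor attention head on `N` tokens with parameters `r`, `c`, `ℓ` and
failure probability `0`: query, key and value embeddings, and for each input a matrix of attention
weights subject to the constraints of the mechanism. -/
structure ANNAHead (N d m : ℕ) (r c ℓ : ℝ) where
  Q : (Fin d → ℝ) → EuclideanSpace ℝ (Fin m)
  K : (Fin d → ℝ) → EuclideanSpace ℝ (Fin m)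
  V : (Fin d → ℝ) → (Fin m → ℝ)
  weight : Rows N d → Rows N N
  weight_nonneg : ∀ X i j, 0 ≤ weight X i j
  weight_sum : ∀ X i, ∑ j, weight X i j = 1
  near_of_pos : ∀ X i j, 0 < weight X i j →
    j ∈ keysNear (Q (X i)) (fun j' => K (X j')) (c * r)
  le_of_near : ∀ X i j, j ∈ keysNear (Q (X i)) (fun j' => K (X j')) r →
    1 / ((((keysNear (Q (X i)) (fun j' => K (X j')) (c * r)).card : ℝ) - 1) * ℓ + 1)
      ≤ weight X i j

namespace ANNAHead

variable {N d m : ℕ} {r c ℓ : ℝ}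

/-- The output of the head: row `i` is `∑ j, w i j • v j`. -/
def eval (A : ANNAHead N d m r c ℓ) (X : Rows N d) : Rows N m :=
  fun i a => ∑ j, A.weight X i j * A.V (X j) a

open Classical in
/-- The head performs exact match attention: the weights of a query are uniform on the keys that are
equal to the query, and zero elsewhere. -/
def IsEMA (A : ANNAHead N d m r c ℓ) : Prop :=
  ∀ X i j, A.weight X i j =
    if A.K (X j) = A.Q (X i) then
      1 / ((Finset.univ.filter (fun j' => A.K (X j') = A.Q (X i))).card : ℝ)
    else 0

end ANNAHead

/-- An attention layer with `H` heads and output matrices `W h`. -/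
structure ANNALayer (N d m H : ℕ) (r c ℓ : ℝ) where
  head : Fin H → ANNAHead N d m r c ℓ
  W : Fin H → Rows m d

/-- The map `X ↦ ∑ h, A_h(X) W_h` computed by a layer. -/
def ANNALayer.eval {N d m H : ℕ} {r c ℓ : ℝ} (f : ANNALayer N d m H r c ℓ)
    (X : Rows N d) : Rows N d :=
  fun i k => ∑ h, ∑ a, (f.head h).eval X i a * f.W h a k

/-- An ANNA-transformer with context length `N`, token dimension `d`, embedding dimension `m` and `H`
heads per layer: a list of layers, applied from the first to the last, and an output function. -/
structure ANNATransformer (N d m H : ℕ) (r c ℓ : ℝ) where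
  layers : List (ANNALayer N d m H r c ℓ)
  ψ : (Fin d → ℝ) → (Fin d → ℝ)

/-- The number of layers. -/
def ANNATransformer.depth {N d m H : ℕ} {r c ℓ : ℝ} (T : ANNATransformer N d m H r c ℓ) : ℕ :=
  T.layers.length

/-- The output of the transformer on the input matrix `X`; `ψ` is applied row by row. -/
def ANNATransformer.eval {N d m H : ℕ} {r c ℓ : ℝ} (T : ANNATransformer N d m H r c ℓ)
    (X : Rows N d) : Rows N d :=
  fun i => T.ψ (T.layers.foldl (fun Y f => f.eval Y) X i)

/-- All heads of the transformer perform exact match attention. -/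
def ANNATransformer.IsEMA {N d m H : ℕ} {r c ℓ : ℝ} (T : ANNATransformer N d m H r c ℓ) : Prop :=
  ∀ f ∈ T.layers, ∀ h, (f.head h).IsEMA

/-! ### Bit precision -/

/-- The signed fixed-point numbers with `b` bits before and `b` bits after the binary point. -/
def IsFixedPoint (b : ℕ) (x : ℝ) : Prop :=
  |x| ≤ 2 ^ b ∧ ∃ z : ℤ, x = (z : ℝ) / 2 ^ b

/-- Rounding of a real number to a nearest fixed-point number (with saturation). -/
noncomputable def roundFixed (b : ℕ) (x : ℝ) : ℝ :=
  max (-2 ^ b) (min (2 ^ b) ((round (x * 2 ^ b) : ℝ) / 2 ^ b))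

/-- A function applied to single tokens works with precision `b`: it is an arbitrary function of the
fixed-point roundings of the coordinates of its argument, with fixed-point coordinates as values. -/
def HasPrecision (b : ℕ) {d m : ℕ} (f : (Fin d → ℝ) → (Fin m → ℝ)) : Prop :=
  (∀ x, f x = f (fun k => roundFixed b (x k))) ∧ ∀ x a, IsFixedPoint b (f x a)

/-- All element-wise operations and all output matrices of the transformer have precision `b`. -/
structure ANNATransformer.Precision {N d m H : ℕ} {r c ℓ : ℝ} (T : ANNATransformer N d m H r c ℓ)
    (b : ℕ) : Prop where
  query : ∀ f ∈ T.layers, ∀ h, HasPrecision b (fun x a => (f.head h).Q x a)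
  key : ∀ f ∈ T.layers, ∀ h, HasPrecision b (fun x a => (f.head h).K x a)
  value : ∀ f ∈ T.layers, ∀ h, HasPrecision b (f.head h).V
  matrix : ∀ f ∈ T.layers, ∀ h a k, IsFixedPoint b (f.W h a k)
  output : HasPrecision b T.ψ

/-! ### Inputs and outputs of a transformer -/

/-- The input matrix of a word sequence: the `i`-th token is `(x i, i, 0, …, 0)`, the `i`-th word
with its position, as real numbers. -/
def tokenMatrix {N p : ℕ} (d : ℕ) (x : Fin N → Word p) : Rows N d :=
  fun i k => if (k : ℕ) = 0 then ((x i).val : ℝ) else if (k : ℕ) = 1 then (i : ℝ) else 0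

/-- The transformer outputs the word sequence `y` on the word sequence `x`: the first coordinate of the
`i`-th output token is the word `y i`, for every `i`. -/
def ANNATransformer.Outputs {N d m H p : ℕ} {r c ℓ : ℝ} (T : ANNATransformer N d m H r c ℓ)
    (x y : Fin N → Word p) : Prop :=
  ∃ hd : 0 < d, ∀ i, T.eval (tokenMatrix d x) i ⟨0, hd⟩ = ((y i).val : ℝ)

/-!
A head with exact match attention whose weights sum to `1` on every input has `Q = K`, as one sees on
inputs with equal rows. Such a head divides the tokens into classes, those with equal keys, and
replaces the value of each token by the average over its class. The simulation only uses classes that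
depend on the positions of the tokens. If the members of a class write their contents, multiplied by
the size of the class, into disjoint blocks of coordinates, then afterwards every member knows the
contents of the whole class exactly, in integers. A second head, with singleton classes, restores the
position of each token, which the averaging erases. Thus a layer performs one step of a computation
in which, for a fixed partition of the tokens into small classes, every token learns all that its
class knows (`GroupComputable`, `GroupComputable.exists_transformer`).

It remains to route the messages of a protocol in boundedly many such steps. A constant fraction of
the tokens is arranged as a cube `Fin L → Fin k` with `k ≤ N ^ (1 / L)`, where `L` is a constant, and
the classes are the lines of the cube. Every node is the home of boundedly many machines, so that it
sends and receives at most `D = O(s)` words. The coordinates of the packets are corrected one after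
the other. In order to prevent congestion in the correction of coordinate `t`, the packets are first
balanced: for each direction above `t`, every line deals the packets with a given coordinate `t` of
their destination evenly to its `k` nodes. Rounding costs one packet for each direction and value of
coordinate `t`. As at most `k ^ (L - t - 1) * D` packets have a destination with given coordinates up
to `t`, a node has at most `D + k * L` packets after the correction, and no more than
`D + 2 * k * L` in between. So the load does not accumulate over the phases, and routing takes at
most `L ^ 2` steps (`GroupComputable.balance`, `GroupComputable.route_phase`,
`GroupComputable.route`).

A local memory is represented by packets that are tagged with sender, receiver and index, hence a
round of the protocol consists of a local computation and a routing
(`MPCProtocol.groupComputable`). A row stores the contents of `O(k)` tokens, that is,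
`O(k * (s + k))` numbers, which is `O(N ^ ε')` for `2 / L ≤ ε' - ε`; two heads are enough.
-/

/-! ### Exact match attention as averaging over classes of tokens -/

theorem IsFixedPoint.natCast {b n : ℕ} (h : n ≤ 2 ^ b) : IsFixedPoint b (n : ℝ) := by
  refine ⟨?_, (n : ℤ) * 2 ^ b, ?_⟩
  · rw [abs_of_nonneg (Nat.cast_nonneg n)]
    exact_mod_cast h
  · push_cast
    field_simp

theorem isFixedPoint_roundFixed (b : ℕ) (x : ℝ) : IsFixedPoint b (roundFixed b x) := by
  have h2 : (0 : ℝ) < 2 ^ b := by positivity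
  refine ⟨abs_le.2 ⟨le_max_left _ _, max_le (by linarith) (min_le_left _ _)⟩, ?_⟩
  unfold roundFixed
  rcases max_choice (-2 ^ b) (min (2 ^ b) ((round (x * 2 ^ b) : ℝ) / 2 ^ b)) with h | h
  · exact ⟨-(2 ^ b * 2 ^ b), by rw [h]; push_cast; field_simp⟩
  · rw [h]
    rcases min_choice ((2 : ℝ) ^ b) ((round (x * 2 ^ b) : ℝ) / 2 ^ b) with h | h
    · exact ⟨2 ^ b * 2 ^ b, by rw [h]; push_cast; field_simp⟩
    · exact ⟨_, h⟩

theorem IsFixedPoint.roundFixed_eq {b : ℕ} {x : ℝ} (h : IsFixedPoint b x) :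
    roundFixed b x = x := by
  obtain ⟨h1, z, rfl⟩ := h
  have h2 : (0 : ℝ) < 2 ^ b := by positivity
  have h3 : (z : ℝ) / 2 ^ b * 2 ^ b = z := by field_simp
  rw [abs_le] at h1
  rw [roundFixed, h3, round_intCast, min_eq_right h1.2, max_eq_right h1.1]

/-- A prescription of fixed-point values on a family of rows with natural number entries extends to a
token-wise function of precision `b`, provided that it is well defined on rows. -/
theorem exists_hasPrecision {ι : Type*} {b d m : ℕ} (Y : ι → Fin d → ℕ) (Z : ι → Fin m → ℕ)
    (hY : ∀ i k, Y i k ≤ 2 ^ b) (hZ : ∀ i a, Z i a ≤ 2 ^ b)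
    (hYZ : ∀ i j, Y i = Y j → Z i = Z j) :
    ∃ F : (Fin d → ℝ) → (Fin m → ℝ), HasPrecision b F ∧
      ∀ i, F (fun k => (Y i k : ℝ)) = fun a => (Z i a : ℝ) := by
  classical
  let G : (Fin d → ℝ) → (Fin m → ℝ) := fun v =>
    if h : ∃ i, v = fun k => (Y i k : ℝ) then fun a => (Z h.choose a : ℝ) else 0
  have hG : ∀ i, G (fun k => (Y i k : ℝ)) = fun a => (Z i a : ℝ) := by
    intro i
    have h : ∃ i', (fun k => (Y i k : ℝ)) = fun k => (Y i' k : ℝ) := ⟨i, rfl⟩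
    have h' : Y i = Y h.choose := by
      funext k
      exact_mod_cast congrFun h.choose_spec k
    simp only [G, dif_pos h, hYZ _ _ h']
  refine ⟨fun v => G (fun k => roundFixed b (v k)), ⟨fun v => ?_, fun v a => ?_⟩, fun i => ?_⟩
  · simp only [(isFixedPoint_roundFixed b _).roundFixed_eq]
  · simp only [G]
    split_ifs with h
    · exact .natCast (hZ _ _)
    · simpa using IsFixedPoint.natCast (b := b) (n := 0) (Nat.zero_le _)
  · simp only [(IsFixedPoint.natCast (hY i _)).roundFixed_eq, hG]

open Classical in
/-- The exact match attention head whose queries and keys are given by the same function `K`: every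
token receives the average of the values in its class, the tokens with the same key. -/
noncomputable def emaHead {N d m : ℕ} {c ℓ : ℝ} (hℓ : 1 ≤ ℓ)
    (K V : (Fin d → ℝ) → (Fin m → ℝ)) : ANNAHead N d m 0 c ℓ where
  Q x := WithLp.toLp 2 (K x)
  K x := WithLp.toLp 2 (K x)
  V := V
  weight X i j := if K (X j) = K (X i) then
    1 / ((Finset.univ.filter (fun j' => K (X j') = K (X i))).card : ℝ) else 0
  weight_nonneg X i j := by split_ifs <;> positivity
  weight_sum X i := by
    rw [← Finset.sum_filter, Finset.sum_const, nsmul_eq_mul, mul_one_div, div_self]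
    have : i ∈ Finset.univ.filter (fun j' => K (X j') = K (X i)) := by simp
    exact_mod_cast (Finset.card_pos.2 ⟨i, this⟩).ne'
  near_of_pos X i j h := by
    have : K (X j) = K (X i) := by
      by_contra h'
      simp [h'] at h
    simp [keysNear, this]
  le_of_near X i j h := by
    have hiff : ∀ j, ‖WithLp.toLp 2 (K (X i)) - WithLp.toLp 2 (K (X j))‖ ≤ 0 ↔
        K (X j) = K (X i) := by
      intro j
      rw [norm_le_zero_iff, sub_eq_zero, (WithLp.toLp_injective 2).eq_iff, eq_comm]
    simp only [keysNear, mul_zero, Finset.mem_filter, Finset.mem_univ, true_and, hiff] at h ⊢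
    rw [if_pos h]
    have h1 : (1 : ℝ) ≤ ((Finset.univ.filter (fun j' => K (X j') = K (X i))).card : ℝ) := by
      have : i ∈ Finset.univ.filter (fun j' => K (X j') = K (X i)) := by simp
      exact_mod_cast Finset.card_pos.2 ⟨i, this⟩
    apply one_div_le_one_div_of_le (by linarith)
    nlinarith

theorem emaHead_isEMA {N d m : ℕ} {c ℓ : ℝ} (hℓ : 1 ≤ ℓ)
    (K V : (Fin d → ℝ) → (Fin m → ℝ)) :
    (emaHead hℓ K V : ANNAHead N d m 0 c ℓ).IsEMA := by
  intro X i j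
  simp only [emaHead, (WithLp.toLp_injective 2).eq_iff]

/-- If the values are scaled by the class sizes, then the head sums over classes. -/
theorem emaHead_eval {N d m : ℕ} {c ℓ : ℝ} (hℓ : 1 ≤ ℓ) {K V : (Fin d → ℝ) → (Fin m → ℝ)}
    {X : Rows N d} {β : Type*} [DecidableEq β] (cl : Fin N → β) (Z : Fin N → Fin m → ℕ)
    (hK : ∀ i j, K (X j) = K (X i) ↔ cl j = cl i)
    (hV : ∀ i a, V (X i) a = ((Finset.univ.filter (fun j => cl j = cl i)).card * Z i a : ℕ))
    (i : Fin N) (a : Fin m) :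
    (emaHead hℓ K V : ANNAHead N d m 0 c ℓ).eval X i a =
      (∑ j with cl j = cl i, Z j a : ℕ) := by
  classical
  simp only [ANNAHead.eval, emaHead, hK]
  rw [Nat.cast_sum, Finset.sum_filter]
  refine Finset.sum_congr rfl fun j _ => ?_
  split_ifs with h
  · have h0 : ((Finset.univ.filter (fun j' => cl j' = cl i)).card : ℝ) ≠ 0 := by
      have : i ∈ Finset.univ.filter (fun j' => cl j' = cl i) := by simp
      exact_mod_cast (Finset.card_pos.2 ⟨i, this⟩).ne'
    rw [hV, h]
    push_cast
    field_simp
  · simp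

/-- The conditions on a single layer that make a transformer an exact match attention transformer of
precision `b`. -/
structure ANNALayer.IsExact {N d m H : ℕ} {r c ℓ : ℝ} (f : ANNALayer N d m H r c ℓ) (b : ℕ) :
    Prop where
  ema : ∀ h, (f.head h).IsEMA
  query : ∀ h, HasPrecision b (fun x a => (f.head h).Q x a)
  key : ∀ h, HasPrecision b (fun x a => (f.head h).K x a)
  value : ∀ h, HasPrecision b (f.head h).V
  matrix : ∀ h a k, IsFixedPoint b (f.W h a k)

/-- A layer with two heads can replace the rows `Y x i` by the sums of arbitrary functions `Z x j` of
the rows `Y x j` over the class of `i`, with the position of `i` added in coordinate `1`. The second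
head restores the position, which the first one erases because its output is constant on classes. -/
theorem exists_layer {X : Type*} {N d b : ℕ} {c ℓ : ℝ} (hℓ : 1 ≤ ℓ) (one : Fin d)
    (Y Z : X → Fin N → Fin d → ℕ) (cl : Fin N → Fin N) (hN : N ≤ 2 ^ b)
    (hY : ∀ x i k, Y x i k ≤ 2 ^ b) (hpos : ∀ x i, Y x i one = i)
    (hZ : ∀ x i k, N * Z x i k ≤ 2 ^ b) (hYZ : ∀ x y i, Y x i = Y y i → Z x i = Z y i) :
    ∃ f : ANNALayer N d d 2 0 c ℓ, f.IsExact b ∧ ∀ x,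
      f.eval (fun i k => (Y x i k : ℝ)) =
        fun i k => (((∑ j with cl j = cl i, Z x j k) + if k = one then (i : ℕ) else 0 : ℕ) : ℝ) := by
  classical
  have hinj : ∀ x y i j, Y x i = Y y j → i = j := fun x y i j h => by
    have := congrFun h one
    rw [hpos, hpos] at this
    exact Fin.ext this
  have key : ∀ (β : Fin N → Fin N) (Z : X → Fin N → Fin d → ℕ) (_ : ∀ x y i, Y x i = Y y i →
      Z x i = Z y i) (_ : ∀ x i k,
      (Finset.univ.filter (fun j => β j = β i)).card * Z x i k ≤ 2 ^ b),
      ∃ A : ANNAHead N d d 0 c ℓ, A.IsEMA ∧ HasPrecision b (fun x a => A.Q x a) ∧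
        HasPrecision b (fun x a => A.K x a) ∧ HasPrecision b A.V ∧ ∀ x i k,
        A.eval (fun i k => (Y x i k : ℝ)) i k = (∑ j with β j = β i, Z x j k : ℕ) := by
    intro β Z hYZ hZ
    obtain ⟨K, hK, hK'⟩ := exists_hasPrecision (b := b) (fun z : X × Fin N => Y z.1 z.2)
      (fun z (_ : Fin d) => (β z.2 : ℕ)) (fun z => hY z.1 z.2)
      (fun z _ => (β z.2).2.le.trans hN)
      (fun z w h => by rw [hinj _ _ _ _ h])
    obtain ⟨V, hV, hV'⟩ := exists_hasPrecision (b := b) (fun z : X × Fin N => Y z.1 z.2)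
      (fun z k => (Finset.univ.filter (fun j => β j = β z.2)).card * Z z.1 z.2 k)
      (fun z => hY z.1 z.2) (fun z => hZ z.1 z.2)
      (fun z w h => by
        obtain ⟨x, i⟩ := z
        obtain ⟨y, j⟩ := w
        obtain rfl := hinj _ _ _ _ h
        simp only at h ⊢
        rw [hYZ x y i h])
    refine ⟨emaHead hℓ K V, emaHead_isEMA hℓ K V, hK, hK, hV, fun x i k => ?_⟩
    refine emaHead_eval hℓ β (Z x) (fun i j => ?_) (fun i a => ?_) i k
    · rw [hK' (x, j), hK' (x, i)]
      refine ⟨fun h => ?_, fun h => by simp [h]⟩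
      exact Fin.ext (by exact_mod_cast congrFun h one)
    · rw [hV' (x, i)]
  obtain ⟨A, hA, hAQ, hAK, hAV, hAe⟩ := key cl Z hYZ fun x i k =>
    (Nat.mul_le_mul_right _ ((Finset.card_le_univ _).trans (by simp))).trans (hZ x i k)
  obtain ⟨I, hI, hIQ, hIK, hIV, hIe⟩ := key id
    (fun _ i k => if k = one then (i : ℕ) else 0) (fun _ _ _ _ => rfl) (fun x i k => by
      simp only [id, Finset.filter_eq', Finset.mem_univ, if_true, Finset.card_singleton, one_mul]
      split_ifs
      · exact i.2.le.trans hN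
      · exact Nat.zero_le _)
  refine ⟨⟨![A, I], fun _ a k => if a = k then 1 else 0⟩, ⟨?_, ?_, ?_, ?_, ?_⟩, fun x => ?_⟩
  · exact Fin.forall_fin_two.2 ⟨hA, hI⟩
  · exact Fin.forall_fin_two.2 ⟨hAQ, hIQ⟩
  · exact Fin.forall_fin_two.2 ⟨hAK, hIK⟩
  · exact Fin.forall_fin_two.2 ⟨hAV, hIV⟩
  · intro _ a k
    dsimp only
    split_ifs
    · simpa using IsFixedPoint.natCast (b := b) (n := 1) Nat.one_le_two_pow
    · simpa using IsFixedPoint.natCast (b := b) (n := 0) (Nat.zero_le _)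
  · funext i k
    simp only [ANNALayer.eval, Fin.sum_univ_two, Matrix.cons_val_zero, Matrix.cons_val_one,
      mul_ite, mul_one, mul_zero, Finset.sum_ite_eq', Finset.mem_univ, if_true, hAe, hIe]
    simp [Finset.filter_eq']

/-! ### Computations by communication inside classes of tokens -/

/-- The contents `U x i` that the tokens hold on the various inputs can be stored in `S` natural
numbers below `B`. -/
def FitsIn {X I Γ : Type} (S B : ℕ) (U : X → I → Γ) : Prop :=
  ∃ code : Γ → Fin S → ℕ, (∀ g s, code g s < B) ∧
    ∀ x y i, code (U x i) = code (U y i) → U x i = U y i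

/-- `GroupComputable N p K S B n U`: in `n` steps, `N` tokens that hold one input word each can reach
a situation in which token `i` holds `U x i` on every input `x`. In a step the tokens are divided
into fixed classes of at most `K` tokens, and every token acquires something that is determined by
the present contents of its class. Between the steps a token holds at most `S` numbers below `B`.
Functions computed by tokens are represented by the condition that equal arguments have equal
values. -/
inductive GroupComputable (N p K S B : ℕ) :
    ℕ → ∀ {Γ : Type}, ((Fin N → Word p) → Fin N → Γ) → Prop
  | input {Γ : Type} (U : (Fin N → Word p) → Fin N → Γ)
      (hU : ∀ x y i, x i = y i → U x i = U y i) (hfit : FitsIn S B U) : GroupComputable N p K S B 0 U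
  | step {n : ℕ} {Γ Γ' : Type} (U : (Fin N → Word p) → Fin N → Γ)
      (U' : (Fin N → Word p) → Fin N → Γ') (cl : Fin N → Fin N) (h : GroupComputable N p K S B n U)
      (hcl : ∀ c, (Finset.univ.filter (fun i => cl i = c)).card ≤ K)
      (hU' : ∀ x y i, (∀ j, cl j = cl i → U x j = U y j) → U' x i = U' y i)
      (hfit : FitsIn S B U') : GroupComputable N p K S B (n + 1) U'

namespace GroupComputable

variable {N p K S B n : ℕ}

/-- Local computations are free. -/
theorem map {Γ Γ' : Type} {U : (Fin N → Word p) → Fin N → Γ} (U' : (Fin N → Word p) → Fin N → Γ')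
    (h : GroupComputable N p K S B n U) (hU' : ∀ x y i, U x i = U y i → U' x i = U' y i)
    (hfit : FitsIn S B U') : GroupComputable N p K S B n U' := by
  cases h with
  | input _ hU _ => exact input U' (fun x y i hxy => hU' x y i (hU x y i hxy)) hfit
  | step U₀ _ cl h₀ hcl hU _ =>
    exact step U₀ U' cl h₀ hcl (fun x y i hxy => hU' x y i (hU x y i hxy)) hfit

end GroupComputable

/-- The members of classes with at most `K` elements can be numbered by `Fin K`. -/
theorem exists_slot {I β : Type*} [Fintype I] [DecidableEq β] {K : ℕ} (cl : I → β)
    (hcl : ∀ c, (Finset.univ.filter (fun i => cl i = c)).card ≤ K) :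
    ∃ slot : I → Fin K, ∀ i j, cl i = cl j → slot i = slot j → i = j := by
  classical
  have h : ∀ c, ∃ f : I → ℕ, ∀ i, cl i = c → f i < K ∧ ∀ j, cl j = c → f i = f j → i = j := by
    intro c
    let e := (Finset.univ.filter (fun i => cl i = c)).equivFin
    refine ⟨fun i => if hi : cl i = c then e ⟨i, by simpa using hi⟩ else 0, fun i hi => ?_⟩
    simp only [hi, dif_pos]
    refine ⟨(e _).2.trans_le (hcl c), fun j hj hij => ?_⟩
    simp only [hj, dif_pos] at hij
    simpa using e.injective (Fin.ext hij)
  choose f hf using h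
  refine ⟨fun i => ⟨f (cl i) i, (hf _ i rfl).1⟩, fun i j hij h => ?_⟩
  refine (hf (cl i) i rfl).2 j hij.symm ?_
  rw [Fin.mk.injEq] at h
  rw [h, hij]

/-- The part of a row that token `j` contributes to its class: its encoded content, written into the
block of coordinates that belongs to the number of `j` in the class. -/
def slotRow {N K S : ℕ} (slot : Fin N → Fin K) (code : Fin N → Fin S → ℕ) (j : Fin N) :
    Fin (2 + K * S) → ℕ :=
  Fin.addCases (fun _ => 0) fun e =>
    if slot j = (finProdFinEquiv.symm e).1 then code j (finProdFinEquiv.symm e).2 else 0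

/-- The row with the encoded contents of the whole class of token `i`, and the position of `i` in
coordinate `1`. -/
def classRow {N K S : ℕ} (cl : Fin N → Fin N) (slot : Fin N → Fin K) (code : Fin N → Fin S → ℕ)
    (i : Fin N) (k : Fin (2 + K * S)) : ℕ :=
  (∑ j with cl j = cl i, slotRow slot code j k) + if k = Fin.castAdd _ 1 then (i : ℕ) else 0

theorem slotRow_le {N K S B : ℕ} {slot : Fin N → Fin K} {code : Fin N → Fin S → ℕ}
    (hB : ∀ i s, code i s ≤ B) (j : Fin N) (k : Fin (2 + K * S)) : slotRow slot code j k ≤ B := by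
  refine Fin.addCases (fun _ => ?_) (fun e => ?_) k
  · simp [slotRow]
  · simp only [slotRow, Fin.addCases_right]
    split_ifs
    · exact hB _ _
    · exact Nat.zero_le _

theorem classRow_position {N K S : ℕ} (cl : Fin N → Fin N) (slot : Fin N → Fin K)
    (code : Fin N → Fin S → ℕ) (i : Fin N) : classRow cl slot code i (Fin.castAdd _ 1) = i := by
  simp only [classRow, slotRow, Fin.addCases_left, Finset.sum_const_zero, if_true, zero_add]

theorem classRow_le {N K S B : ℕ} {cl : Fin N → Fin N} {slot : Fin N → Fin K}
    {code : Fin N → Fin S → ℕ} (hB : ∀ i s, code i s ≤ B) (i : Fin N) (k : Fin (2 + K * S)) :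
    classRow cl slot code i k ≤ N * B + N := by
  refine Nat.add_le_add ((Finset.sum_le_card_nsmul _ _ B fun j _ => slotRow_le hB j k).trans ?_) ?_
  · rw [smul_eq_mul]
    exact Nat.mul_le_mul_right _ ((Finset.card_le_univ _).trans (by simp))
  · split_ifs
    · exact i.2.le
    · exact Nat.zero_le _

/-- The contents of a class can be read off from its row. -/
theorem classRow_block {N K S : ℕ} {cl : Fin N → Fin N} {slot : Fin N → Fin K}
    (hslot : ∀ i j, cl i = cl j → slot i = slot j → i = j) (code : Fin N → Fin S → ℕ)
    {i j : Fin N} (hij : cl j = cl i) (s : Fin S) :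
    classRow cl slot code i (Fin.natAdd 2 (finProdFinEquiv (slot j, s))) = code j s := by
  have hne : (Fin.natAdd 2 (finProdFinEquiv (slot j, s)) : Fin (2 + K * S)) ≠ Fin.castAdd _ 1 := by
    intro h
    have := congrArg Fin.val h
    simp at this
    omega
  simp only [classRow, slotRow, Fin.addCases_right, Equiv.symm_apply_apply, if_neg hne, add_zero]
  rw [Finset.sum_eq_single_of_mem j (by simpa using hij)]
  · simp
  · intro j' hj' hne'
    rw [if_neg]
    intro h
    exact hne' (hslot _ _ ((by simpa using hj' : cl j' = cl i).trans hij.symm) h)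

/-- One step in terms of rows: rows that determine the contents `U` can be turned into the rows that
collect these contents over classes. -/
theorem exists_layer_classRow {N p K S B b : ℕ} {c ℓ : ℝ} (hℓ : 1 ≤ ℓ) (hb : N * B + N ≤ 2 ^ b)
    {Γ : Type} {U : (Fin N → Word p) → Fin N → Γ} {code : Γ → Fin S → ℕ}
    (hcode : ∀ g s, code g s < B) (Y : (Fin N → Word p) → Fin N → Fin (2 + K * S) → ℕ)
    (hY : ∀ x i k, Y x i k ≤ 2 ^ b) (hpos : ∀ x i, Y x i (Fin.castAdd _ 1) = i)
    (hYU : ∀ x y i, Y x i = Y y i → U x i = U y i) (cl : Fin N → Fin N) (slot : Fin N → Fin K) :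
    ∃ f : ANNALayer N (2 + K * S) (2 + K * S) 2 0 c ℓ, f.IsExact b ∧ ∀ x,
      f.eval (fun i k => (Y x i k : ℝ)) =
        fun i k => (classRow cl slot (fun j => code (U x j)) i k : ℝ) :=
  exists_layer hℓ _ Y (fun x => slotRow slot fun j => code (U x j)) cl (by omega) hY hpos
    (fun x i k => (Nat.mul_le_mul_left N (slotRow_le (fun j s => (hcode _ s).le) i k)).trans
      (by omega))
    (fun x y i h => by
      funext k
      simp only [slotRow, hYU x y i h])

/-- After `n` steps of a computation in classes, `n + 1` layers have collected the contents of the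
classes of any following step. -/
theorem GroupComputable.exists_layers {N p K S B b n : ℕ} {c ℓ : ℝ} (hℓ : 1 ≤ ℓ)
    (hp : 2 ^ p ≤ 2 ^ b) (hb : N * B + N ≤ 2 ^ b) {Γ : Type} {U : (Fin N → Word p) → Fin N → Γ}
    (h : GroupComputable N p K S B n U) (cl : Fin N → Fin N)
    (hcl : ∀ c, (Finset.univ.filter (fun i => cl i = c)).card ≤ K) :
    ∃ (Y : (Fin N → Word p) → Fin N → Fin (2 + K * S) → ℕ)
      (layers : List (ANNALayer N (2 + K * S) (2 + K * S) 2 0 c ℓ)),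
      layers.length = n + 1 ∧ (∀ f ∈ layers, f.IsExact b) ∧
      (∀ x, layers.foldl (fun Y f => f.eval Y) (tokenMatrix _ x) = fun i k => (Y x i k : ℝ)) ∧
      (∀ x i k, Y x i k ≤ 2 ^ b) ∧ (∀ x i, Y x i (Fin.castAdd _ 1) = i) ∧
      ∀ x y i, Y x i = Y y i → ∀ j, cl j = cl i → U x j = U y j := by
  have hcol : ∀ {Γ : Type} (U : (Fin N → Word p) → Fin N → Γ) (code : Γ → Fin S → ℕ)
      (_ : ∀ x y i, code (U x i) = code (U y i) → U x i = U y i) (cl : Fin N → Fin N)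
      (slot : Fin N → Fin K) (_ : ∀ i j, cl i = cl j → slot i = slot j → i = j) (x y) (i : Fin N),
      classRow cl slot (fun j => code (U x j)) i = classRow cl slot (fun j => code (U y j)) i →
      ∀ j, cl j = cl i → U x j = U y j := by
    intro Γ U code hinj cl slot hslot x y i hxy j hj
    refine hinj x y j (funext fun s => ?_)
    rw [← classRow_block hslot (fun j => code (U x j)) hj, hxy, classRow_block hslot _ hj]
  induction h generalizing cl with
  | input U hU hfit =>
    obtain ⟨code, hcode, hinj⟩ := hfit
    obtain ⟨slot, hslot⟩ := exists_slot cl hcl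
    let Y : (Fin N → Word p) → Fin N → Fin (2 + K * S) → ℕ := fun x i k =>
      if (k : ℕ) = 0 then (x i).val else if (k : ℕ) = 1 then i else 0
    obtain ⟨f, hf, hfe⟩ := exists_layer_classRow (c := c) hℓ hb (U := U) hcode Y
      (fun x i k => by
        simp only [Y]
        split_ifs
        · exact (ZMod.val_lt (x i)).le.trans hp
        · have := i.2
          omega
        · exact Nat.zero_le _)
      (fun x i => by simp [Y, -Fin.val_eq_zero_iff])
      (fun x y i h => hU x y i (ZMod.val_injective _ (by
        simpa [Y, -Fin.val_eq_zero_iff] using congrFun h (Fin.castAdd _ 0)))) cl slot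
    refine ⟨fun x => classRow cl slot fun j => code (U x j), [f], rfl, by simpa using hf, fun x => ?_,
      fun x i k => (classRow_le (fun j s => (hcode _ s).le) i k).trans hb,
      fun x i => classRow_position .., hcol U code hinj cl slot hslot⟩
    rw [List.foldl_cons, List.foldl_nil, ← hfe]
    congr 1
    funext i k
    simp only [Y, tokenMatrix]
    split_ifs <;> simp
  | step U U' cl' h hcl' hU' hfit ih =>
    obtain ⟨code, hcode, hinj⟩ := hfit
    obtain ⟨slot, hslot⟩ := exists_slot cl hcl
    obtain ⟨Y, layers, hlen, hex, heval, hY, hpos, hdet⟩ := ih cl' hcl'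
    obtain ⟨f, hf, hfe⟩ := exists_layer_classRow (c := c) hℓ hb (U := U') hcode Y hY hpos
      (fun x y i h => hU' x y i (hdet x y i h)) cl slot
    refine ⟨fun x => classRow cl slot fun j => code (U' x j), layers ++ [f], by simp [hlen],
      fun g hg => ?_, fun x => ?_,
      fun x i k => (classRow_le (fun j s => (hcode _ s).le) i k).trans hb,
      fun x i => classRow_position .., hcol U' code hinj cl slot hslot⟩
    · rcases List.mem_append.1 hg with hg | hg
      · exact hex g hg
      · rw [List.mem_singleton.1 hg]
        exact hf
    · rw [List.foldl_append, heval, List.foldl_cons, List.foldl_nil, hfe]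

/-- A computation in classes is performed by an exact match attention transformer. -/
theorem GroupComputable.exists_transformer {N p K S B b n : ℕ} {c ℓ : ℝ} (hℓ : 1 ≤ ℓ)
    (hK : 0 < K) (hp : 2 ^ p ≤ 2 ^ b) (hb : N * B + N ≤ 2 ^ b)
    {U : (Fin N → Word p) → Fin N → Word p} (h : GroupComputable N p K S B n U) :
    ∃ T : ANNATransformer N (2 + K * S) (2 + K * S) 2 0 c ℓ,
      T.depth = n + 1 ∧ T.Precision b ∧ T.IsEMA ∧ ∀ x, T.Outputs x (U x) := by
  obtain ⟨Y, layers, hlen, hex, heval, hY, hpos, hdet⟩ := h.exists_layers (c := c) hℓ hp hb id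
    (fun i => by
      simp only [id, Finset.filter_eq', Finset.mem_univ, if_true, Finset.card_singleton]
      exact hK)
  obtain ⟨ψ, hψ, hψe⟩ := exists_hasPrecision (b := b) (fun z : (Fin N → Word p) × Fin N => Y z.1 z.2)
    (fun z (_ : Fin (2 + K * S)) => (U z.1 z.2).val) (fun z => hY z.1 z.2)
    (fun z _ => (ZMod.val_lt _).le.trans hp)
    (fun z w hzw => by
      obtain ⟨x, i⟩ := z
      obtain ⟨y, j⟩ := w
      obtain rfl : i = j := Fin.ext (by rw [← hpos x i, ← hpos y j, hzw])
      simp only at hzw ⊢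
      rw [hdet x y i hzw i rfl])
  refine ⟨⟨layers, ψ⟩, hlen, ⟨fun f hf => (hex f hf).query, fun f hf => (hex f hf).key,
    fun f hf => (hex f hf).value, fun f hf => (hex f hf).matrix, hψ⟩, fun f hf => (hex f hf).ema,
    fun x => ⟨by omega, fun i => ?_⟩⟩
  simp only [ANNATransformer.eval, heval]
  rw [hψe (x, i)]

/-! ### Deterministic routing on a cube -/

theorem fitsIn_finset {X I τ : Type} [Fintype τ] {S B : ℕ} (hB : Fintype.card τ < B)
    (U : X → I → Finset τ) (hS : ∀ x i, (U x i).card ≤ S) : FitsIn S B U := by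
  classical
  let e := Fintype.equivFin τ
  refine ⟨fun F s => ((F.toList[(s : ℕ)]?).map fun t => (e t : ℕ) + 1).getD 0, fun F s => ?_,
    fun x y i h => ?_⟩
  · simp only
    rcases F.toList[(s : ℕ)]? with _ | t
    · simpa using Nat.zero_lt_of_lt hB
    · have := (e t).2
      simp only [Option.map_some, Option.getD_some]
      omega
  · have hl : (U x i).toList = (U y i).toList := by
      refine List.ext_getElem? fun s => ?_
      by_cases hs : s < S
      · have h := congrFun h ⟨s, hs⟩
        simp only at h
        revert h
        rcases (U x i).toList[s]? with _ | t <;> rcases (U y i).toList[s]? with _ | t' <;> intro h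
        · rfl
        · simp at h
        · simp at h
        · simpa [Fin.val_inj] using h
      · have hx := hS x i
        have hy := hS y i
        rw [List.getElem?_eq_none (by simp; omega), List.getElem?_eq_none (by simp; omega)]
    rw [← Finset.toList_toFinset (U x i), hl, Finset.toList_toFinset]

/-- A rule that deals the elements of any finite set evenly to `k` places. -/
theorem exists_balanced {τ : Type} {k : ℕ} (hk : 0 < k) :
    ∃ deal : Finset τ → τ → Fin k, ∀ (A : Finset τ) (r : Fin k),
      k * (A.filter (fun e => deal A e = r)).card ≤ A.card + k := by
  classical
  refine ⟨fun A e => if h : e ∈ A then ⟨A.equivFin ⟨e, h⟩ % k, Nat.mod_lt _ hk⟩ else ⟨0, hk⟩,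
    fun A r => ?_⟩
  have h : (A.filter fun e => (if h : e ∈ A then
      (⟨A.equivFin ⟨e, h⟩ % k, Nat.mod_lt _ hk⟩ : Fin k) else ⟨0, hk⟩) = r).card ≤
      (Finset.range (A.card / k + 1)).card := by
    refine Finset.card_le_card_of_injOn
      (fun e => if h : e ∈ A then A.equivFin ⟨e, h⟩ / k else 0) (fun e he => ?_) ?_
    · have he' : e ∈ A := (Finset.mem_filter.1 he).1
      simp only [he', dif_pos, Finset.coe_range, Set.mem_Iio, Nat.lt_succ_iff]
      exact Nat.div_le_div_right (A.equivFin ⟨e, he'⟩).2.le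
    · intro e he e' he' hee'
      obtain ⟨h1, h2⟩ := Finset.mem_filter.1 he
      obtain ⟨h1', h2'⟩ := Finset.mem_filter.1 he'
      simp only [h1, h1', dif_pos] at h2 h2' hee'
      have hmod := congrArg Fin.val (h2.trans h2'.symm)
      simp only at hmod
      have : (A.equivFin ⟨e, h1⟩ : ℕ) = A.equivFin ⟨e', h1'⟩ := by
        rw [← Nat.div_add_mod (A.equivFin ⟨e, h1⟩ : ℕ) k, hmod, hee', Nat.div_add_mod]
      simpa using A.equivFin.injective (Fin.ext this)
  rw [Finset.card_range] at h
  calc _ ≤ k * (A.card / k + 1) := Nat.mul_le_mul_left k h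
    _ = k * (A.card / k) + k := by ring
    _ ≤ A.card + k := Nat.add_le_add_right (Nat.mul_div_le _ _) _

/-- The packets in `E` that are located, according to `loc`, in the subcube through `v` in the
directions `J`. -/
def cube {τ : Type} {L k : ℕ} (E : Finset τ) (loc : τ → Fin L → Fin k) (J : Finset (Fin L))
    (v : Fin L → Fin k) : Finset τ :=
  E.filter fun e => ∀ j ∉ J, loc e j = v j

section cube

variable {τ : Type} {L k : ℕ} {E : Finset τ} {loc : τ → Fin L → Fin k} {J : Finset (Fin L)}
  {v : Fin L → Fin k}

theorem mem_cube {e : τ} : e ∈ cube E loc J v ↔ e ∈ E ∧ ∀ j ∉ J, loc e j = v j := Finset.mem_filter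

theorem mem_cube_empty {e : τ} : e ∈ cube E loc ∅ v ↔ e ∈ E ∧ loc e = v := by
  simp [mem_cube, funext_iff]

theorem card_cube_insert {a : Fin L} (ha : a ∉ J) :
    (cube E loc (insert a J) v).card = ∑ r, (cube E loc J (Function.update v a r)).card := by
  rw [Finset.card_eq_sum_card_fiberwise (f := fun e => loc e a) (t := Finset.univ) (by simp)]
  refine Finset.sum_congr rfl fun r _ => congrArg Finset.card (Finset.ext fun e => ?_)
  simp only [Finset.mem_filter, mem_cube, Finset.mem_insert, not_or, and_assoc]
  refine and_congr_right fun _ => ⟨fun ⟨h1, h2⟩ j hj => ?_, fun h => ⟨fun j hj => ?_, ?_⟩⟩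
  · by_cases hja : j = a
    · subst hja
      simpa using h2
    · rw [Function.update_of_ne hja]
      exact h1 j ⟨hja, hj⟩
  · rw [h j hj.2, Function.update_of_ne hj.1]
  · rw [h a ha, Function.update_self]

theorem card_cube_le {D : ℕ} (hD : ∀ v, (cube E loc ∅ v).card ≤ D) (J : Finset (Fin L))
    (v : Fin L → Fin k) : (cube E loc J v).card ≤ k ^ J.card * D := by
  induction J using Finset.induction_on generalizing v with
  | empty => simpa using hD v
  | insert a J ha ih =>
    rw [card_cube_insert ha, Finset.card_insert_of_notMem ha, pow_succ]
    refine (Finset.sum_le_card_nsmul _ _ _ fun r _ => ih _).trans ?_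
    rw [Finset.card_univ, Fintype.card_fin, smul_eq_mul]
    exact le_of_eq (by ring)

end cube

/-- The set of packets held by token `i` on input `x`, when the packets in `E x` are located at the
nodes of a cube, and node `v` is the token `emb v`. -/
def held {N p L k : ℕ} {τ : Type} (emb : (Fin L → Fin k) → Fin N)
    (E : (Fin N → Word p) → Finset τ) (loc : (Fin N → Word p) → τ → Fin L → Fin k)
    (x : Fin N → Word p) (i : Fin N) : Finset τ :=
  (E x).filter fun e => emb (loc x e) = i

section route

variable {N p K S B n L k : ℕ} {τ : Type} {emb : (Fin L → Fin k) → Fin N}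
  {E : (Fin N → Word p) → Finset τ} {loc : (Fin N → Word p) → τ → Fin L → Fin k}

theorem held_emb (hemb : Function.Injective emb) (x : Fin N → Word p) (v : Fin L → Fin k) :
    held emb E loc x (emb v) = cube (E x) (loc x) ∅ v := by
  ext e
  simp [held, mem_cube_empty, hemb.eq_iff]

theorem held_of_notMem_range {i : Fin N} (hi : ∀ v, emb v ≠ i) (x : Fin N → Word p) :
    held emb E loc x i = ∅ :=
  Finset.filter_eq_empty_iff.2 fun _ _ => hi _

theorem fitsIn_held [Fintype τ] (hemb : Function.Injective emb) (hB : Fintype.card τ < B)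
    (hS : ∀ x v, (cube (E x) (loc x) ∅ v).card ≤ S) : FitsIn S B (held emb E loc) := by
  refine fitsIn_finset hB _ fun x i => ?_
  by_cases hi : ∃ v, emb v = i
  · obtain ⟨v, rfl⟩ := hi
    rw [held_emb hemb]
    exact hS x v
  · push Not at hi
    simp [held_of_notMem_range hi]

/-- A basic routing step: the nodes of each line in direction `a` redistribute their packets among
themselves, by a rule that depends on the set of packets in the line. -/
theorem GroupComputable.redistribute [Fintype τ] (hemb : Function.Injective emb) (hk : 0 < k)
    (hkK : k ≤ K) (hB : Fintype.card τ < B) (h : GroupComputable N p K S B n (held emb E loc))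
    (a : Fin L) (rule : Finset τ → τ → Fin k) {loc' : (Fin N → Word p) → τ → Fin L → Fin k}
    (hloc' : ∀ x e, loc' x e =
      Function.update (loc x e) a (rule (cube (E x) (loc x) {a} (loc x e)) e))
    (hS : ∀ x v, (cube (E x) (loc' x) ∅ v).card ≤ S) :
    GroupComputable N p K S B (n + 1) (held emb E loc') := by
  classical
  let base : (Fin L → Fin k) → Fin N := fun v => emb (Function.update v a ⟨0, hk⟩)
  let cl : Fin N → Fin N := fun i => if h : ∃ v, emb v = i then base h.choose else i
  have hcl : ∀ v, cl (emb v) = base v := by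
    intro v
    have h : ∃ w, emb w = emb v := ⟨v, rfl⟩
    simp only [cl, dif_pos h, hemb h.choose_spec]
  have hcl' : ∀ i, (∀ v, emb v ≠ i) → cl i = i := by
    intro i hi
    simp only [cl]
    rw [dif_neg]
    simpa using hi
  have hpool : ∀ x v w, (∀ j ≠ a, v j = w j) →
      cube (E x) (loc x) {a} v = cube (E x) (loc x) {a} w := by
    intro x v w hvw
    ext e
    simp only [mem_cube, Finset.mem_singleton]
    exact and_congr_right fun _ => forall₂_congr fun j hj => by rw [hvw j hj]
  refine h.step _ _ cl (fun c => ?_) (fun x y i hxy => ?_) (fitsIn_held hemb hB hS)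
  · by_cases hc : ∃ v, emb v = c
    · obtain ⟨w, rfl⟩ := hc
      refine le_trans (Finset.card_le_card (t := Finset.univ.image
        fun r => emb (Function.update w a r)) fun i hi => ?_)
        (Finset.card_image_le.trans (by simpa using hkK))
      have hi : cl i = emb w := (Finset.mem_filter.1 hi).2
      by_cases hi' : ∃ v, emb v = i
      · obtain ⟨v, rfl⟩ := hi'
        rw [hcl] at hi
        refine Finset.mem_image.2 ⟨v a, Finset.mem_univ _, ?_⟩
        rw [← hemb hi]
        simp
      · push Not at hi'
        rw [hcl' i hi'] at hi
        exact absurd hi.symm (hi' w)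
    · push Not at hc
      refine le_trans (Finset.card_le_card (t := {c}) fun i hi => ?_) (by simp; omega)
      have hi : cl i = c := (Finset.mem_filter.1 hi).2
      by_cases hi' : ∃ v, emb v = i
      · obtain ⟨v, rfl⟩ := hi'
        rw [hcl] at hi
        exact absurd hi (hc _)
      · push Not at hi'
        rw [hcl' i hi'] at hi
        simp [hi]
  · by_cases hi : ∃ v, emb v = i
    · obtain ⟨v, rfl⟩ := hi
      have hcube : ∀ x e, e ∈ cube (E x) (loc x) {a} v ↔
          e ∈ held emb E loc x (emb (Function.update v a (loc x e a))) := by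
        intro x e
        rw [held_emb hemb, mem_cube_empty, mem_cube]
        refine and_congr_right fun _ => ?_
        rw [eq_comm, Function.update_eq_iff]
        simp [eq_comm]
      have hsub : ∀ x y, (∀ j, cl j = cl (emb v) → held emb E loc x j = held emb E loc y j) →
          cube (E x) (loc x) {a} v ⊆ cube (E y) (loc y) {a} v := by
        intro x y hxy e he
        rw [hcube, hxy _ (by simp [hcl, base]), held_emb hemb, mem_cube_empty] at he
        rw [mem_cube]
        refine ⟨he.1, fun j hj => ?_⟩
        rw [he.2, Function.update_of_ne (by simpa using hj)]
      have heq : cube (E x) (loc x) {a} v = cube (E y) (loc y) {a} v :=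
        (hsub x y hxy).antisymm (hsub y x fun j hj => (hxy j hj).symm)
      have hnew : ∀ x, held emb E loc' x (emb v) =
          (cube (E x) (loc x) {a} v).filter
            fun e => rule (cube (E x) (loc x) {a} v) e = v a := by
        intro x
        ext e
        rw [held_emb hemb, mem_cube_empty, Finset.mem_filter, mem_cube, and_assoc, hloc',
          Function.update_eq_iff]
        refine and_congr_right fun _ => ?_
        simp only [Finset.mem_singleton]
        constructor
        · rintro ⟨h1, h2⟩
          exact ⟨h2, by rw [← hpool x _ _ h2]; exact h1⟩
        · rintro ⟨h1, h2⟩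
          exact ⟨by rw [hpool x _ _ h1]; exact h2, h1⟩
      rw [hnew, hnew, heq]
    · push Not at hi
      rw [held_of_notMem_range hi, held_of_notMem_range hi]

/-- Balancing: by dealing the packets of each class evenly along the directions in `J`, one after the
other, the packets of each class get spread evenly over the subcubes in the directions `J`, up to an
error of `1` for each direction. The total load of a node grows by at most `k` in each step. -/
theorem GroupComputable.balance [Fintype τ] (hemb : Function.Injective emb) (hk : 0 < k)
    (hkK : k ≤ K) (hB : Fintype.card τ < B) (h : GroupComputable N p K S B n (held emb E loc))
    {D : ℕ} (hD : ∀ x v, (cube (E x) (loc x) ∅ v).card ≤ D) (cls : τ → Fin k)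
    (J : Finset (Fin L)) (hS : D + J.card * k ≤ S) :
    ∃ loc' : (Fin N → Word p) → τ → Fin L → Fin k,
      GroupComputable N p K S B (n + J.card) (held emb E loc') ∧
      (∀ x e, ∀ j ∉ J, loc' x e j = loc x e j) ∧
      (∀ x v, (cube (E x) (loc' x) ∅ v).card ≤ D + J.card * k) ∧
      ∀ x v c, k ^ J.card * (cube ((E x).filter (cls · = c)) (loc' x) ∅ v).card ≤
        (cube ((E x).filter (cls · = c)) (loc x) J v).card + J.card * k ^ J.card := by
  classical
  induction J using Finset.induction_on with
  | empty => exact ⟨loc, by simpa using h, by simp, by simpa using hD, by simp⟩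
  | insert a J ha ih =>
    rw [Finset.card_insert_of_notMem ha] at hS ⊢
    obtain ⟨loc₁, h₁, hoff, hload, hcls⟩ := ih (by nlinarith)
    obtain ⟨deal, hdeal⟩ := exists_balanced (τ := τ) hk
    let rule : Finset τ → τ → Fin k := fun A e => deal (A.filter (cls · = cls e)) e
    let loc₂ : (Fin N → Word p) → τ → Fin L → Fin k := fun x e =>
      Function.update (loc₁ x e) a (rule (cube (E x) (loc₁ x) {a} (loc₁ x e)) e)
    have hline : ∀ x v c, k * (cube ((E x).filter (cls · = c)) (loc₂ x) ∅ v).card ≤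
        (cube ((E x).filter (cls · = c)) (loc₁ x) {a} v).card + k := by
      intro x v c
      refine le_trans (Nat.mul_le_mul_left k (Finset.card_le_card fun e he => ?_))
        (hdeal (cube ((E x).filter (cls · = c)) (loc₁ x) {a} v) (v a))
      rw [mem_cube_empty, Finset.mem_filter] at he
      obtain ⟨⟨heE, rfl⟩, hv⟩ := he
      simp only [loc₂, Function.update_eq_iff] at hv
      obtain ⟨hva, hv⟩ := hv
      refine Finset.mem_filter.2 ⟨mem_cube.2 ⟨Finset.mem_filter.2 ⟨heE, rfl⟩, by simpa using hv⟩, ?_⟩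
      rw [← hva]
      simp only [rule]
      congr 1
      ext e'
      simp only [mem_cube, Finset.mem_filter, Finset.mem_singleton]
      constructor
      · rintro ⟨⟨h1, h2⟩, h3⟩
        exact ⟨⟨h1, fun j hj => (h3 j hj).trans (hv j hj).symm⟩, h2⟩
      · rintro ⟨⟨h1, h3⟩, h2⟩
        exact ⟨⟨h1, h2⟩, fun j hj => (h3 j hj).trans (hv j hj)⟩
    have hfib : ∀ (l : τ → Fin L → Fin k) x (I : Finset (Fin L)) v, (cube (E x) l I v).card =
        ∑ c, (cube ((E x).filter (cls · = c)) l I v).card := by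
      intro l x I v
      rw [Finset.card_eq_sum_card_fiberwise (f := cls) (t := Finset.univ) (by simp)]
      refine Finset.sum_congr rfl fun c _ => congrArg Finset.card (Finset.ext fun e => ?_)
      simp only [Finset.mem_filter, mem_cube]
      tauto
    have hload₂ : ∀ x v, (cube (E x) (loc₂ x) ∅ v).card ≤ D + (J.card + 1) * k := by
      intro x v
      refine Nat.le_of_mul_le_mul_left ?_ hk
      calc k * (cube (E x) (loc₂ x) ∅ v).card
          ≤ ∑ c, ((cube ((E x).filter (cls · = c)) (loc₁ x) {a} v).card + k) := by
            rw [hfib, Finset.mul_sum]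
            exact Finset.sum_le_sum fun c _ => hline x v c
        _ = (cube (E x) (loc₁ x) {a} v).card + k * k := by
            rw [Finset.sum_add_distrib, ← hfib]
            simp
        _ ≤ k * (D + J.card * k) + k * k := by
            have := card_cube_le (hload x) {a} v
            simp only [Finset.card_singleton, pow_one] at this
            omega
        _ = k * (D + (J.card + 1) * k) := by ring
    refine ⟨loc₂, h₁.redistribute hemb hk hkK hB a rule (fun _ _ => rfl)
      (fun x v => (hload₂ x v).trans hS), fun x e j hj => ?_, hload₂, fun x v c => ?_⟩
    · rw [Finset.mem_insert, not_or] at hj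
      simp only [loc₂, Function.update_of_ne hj.1]
      exact hoff x e j hj.2
    · calc k ^ (J.card + 1) * (cube ((E x).filter (cls · = c)) (loc₂ x) ∅ v).card
          = k ^ J.card * (k * (cube ((E x).filter (cls · = c)) (loc₂ x) ∅ v).card) := by ring
        _ ≤ k ^ J.card * ((cube ((E x).filter (cls · = c)) (loc₁ x) {a} v).card + k) :=
            Nat.mul_le_mul_left _ (hline x v c)
        _ = ∑ r, k ^ J.card *
              (cube ((E x).filter (cls · = c)) (loc₁ x) ∅ (Function.update v a r)).card +
              k ^ (J.card + 1) := by
            rw [← Finset.mul_sum, ← card_cube_insert (Finset.notMem_empty a)]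
            simp only [insert_empty_eq]
            ring
        _ ≤ ∑ r, ((cube ((E x).filter (cls · = c)) (loc x) J (Function.update v a r)).card +
              J.card * k ^ J.card) + k ^ (J.card + 1) :=
            Nat.add_le_add_right (Finset.sum_le_sum fun r _ => hcls x _ c) _
        _ = _ := by
            rw [Finset.sum_add_distrib, ← card_cube_insert ha]
            simp only [Finset.sum_const, Finset.card_univ, Fintype.card_fin, smul_eq_mul]
            ring

/-- One phase of the routing: packets whose coordinates below `t` agree with those of their
destination are balanced over the directions above `t`, according to coordinate `t` of the
destination, and then moved to the right coordinate `t`. -/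
theorem GroupComputable.route_phase [Fintype τ] (hemb : Function.Injective emb) (hk : 0 < k)
    (hkK : k ≤ K) (hB : Fintype.card τ < B) (h : GroupComputable N p K S B n (held emb E loc))
    {D : ℕ} (dst : τ → Fin L → Fin k) (hS : D + 2 * (k * L) ≤ S)
    (hload : ∀ x v, (cube (E x) (loc x) ∅ v).card ≤ D + k * L)
    (hdst : ∀ x v, (cube (E x) dst ∅ v).card ≤ D) (t : Fin L)
    (ht : ∀ x e, ∀ j < t, loc x e j = dst e j) :
    ∃ n' ≤ n + L, ∃ loc' : (Fin N → Word p) → τ → Fin L → Fin k,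
      GroupComputable N p K S B n' (held emb E loc') ∧
      (∀ x v, (cube (E x) (loc' x) ∅ v).card ≤ D + k * L) ∧
      ∀ x e, ∀ j ≤ t, loc' x e j = dst e j := by
  classical
  let J : Finset (Fin L) := Finset.Ioi t
  have hJ : J.card + 1 ≤ L := by
    have := t.2
    simp only [J, Fin.card_Ioi]
    omega
  have hJk : k * J.card ≤ k * L := Nat.mul_le_mul_left _ (by omega)
  obtain ⟨loc₁, h₁, hoff, -, hcls⟩ := h.balance hemb hk hkK hB hload (fun e => dst e t) J
    (by rw [mul_comm J.card]; omega)
  let loc₂ : (Fin N → Word p) → τ → Fin L → Fin k := fun x e =>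
    Function.update (loc₁ x e) t (dst e t)
  have htJ : t ∉ J := by simp [J]
  have hload₂ : ∀ x v, (cube (E x) (loc₂ x) ∅ v).card ≤ D + k * L := by
    intro x v
    let F := (E x).filter fun e => dst e t = v t
    refine le_trans ?_ (Nat.add_le_add_left hJk D)
    refine Nat.le_of_mul_le_mul_left ?_ (pow_pos hk J.card)
    calc k ^ J.card * (cube (E x) (loc₂ x) ∅ v).card
        ≤ k ^ J.card * (cube F (loc₁ x) {t} v).card := by
          refine Nat.mul_le_mul_left _ (Finset.card_le_card fun e he => ?_)
          rw [mem_cube_empty] at he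
          simp only [loc₂, Function.update_eq_iff] at he
          exact mem_cube.2 ⟨Finset.mem_filter.2 ⟨he.1, he.2.1⟩, by simpa using he.2.2⟩
      _ = ∑ r, k ^ J.card * (cube F (loc₁ x) ∅ (Function.update v t r)).card := by
          rw [← Finset.mul_sum, ← card_cube_insert (Finset.notMem_empty t), insert_empty_eq]
      _ ≤ ∑ r, ((cube F (loc x) J (Function.update v t r)).card + J.card * k ^ J.card) :=
          Finset.sum_le_sum fun r _ => hcls x _ _
      _ = (cube F (loc x) (insert t J) v).card + k ^ J.card * (k * J.card) := by
          rw [Finset.sum_add_distrib, ← card_cube_insert htJ]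
          simp only [Finset.sum_const, Finset.card_univ, Fintype.card_fin, smul_eq_mul]
          ring
      _ ≤ (cube (E x) dst J v).card + k ^ J.card * (k * J.card) := by
          refine Nat.add_le_add_right (Finset.card_le_card fun e he => ?_) _
          rw [mem_cube, Finset.mem_filter] at he
          refine mem_cube.2 ⟨he.1.1, fun j hj => ?_⟩
          rcases eq_or_lt_of_le (not_lt.1 (by simpa [J] using hj) : j ≤ t) with rfl | hjt
          · exact he.1.2
          · rw [← ht x e j hjt]
            exact he.2 j (by simp [hjt.ne, hj])
      _ ≤ k ^ J.card * D + k ^ J.card * (k * J.card) :=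
          Nat.add_le_add_right (card_cube_le (hdst x) J v) _
      _ = k ^ J.card * (D + k * J.card) := by ring
  refine ⟨n + J.card + 1, by omega, loc₂, h₁.redistribute hemb hk hkK hB t (fun _ e => dst e t)
    (fun _ _ => rfl) (fun x v => (hload₂ x v).trans (by omega)), hload₂, fun x e j hj => ?_⟩
  rcases eq_or_lt_of_le hj with rfl | hjt
  · simp [loc₂]
  · simp only [loc₂, Function.update_of_ne hjt.ne]
    rw [hoff x e j (by simp [J, hjt.le]), ht x e j hjt]

/-- Routing: any placement of packets can be changed into any other one in `L ^ 2` steps, if both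
placements put at most `D` packets on a node. -/
theorem GroupComputable.route [Fintype τ] (hemb : Function.Injective emb) (hk : 0 < k)
    (hkK : k ≤ K) (hB : Fintype.card τ < B) (h : GroupComputable N p K S B n (held emb E loc))
    {D : ℕ} (dst : τ → Fin L → Fin k) (hS : D + 2 * (k * L) ≤ S)
    (hload : ∀ x v, (cube (E x) (loc x) ∅ v).card ≤ D)
    (hdst : ∀ x v, (cube (E x) dst ∅ v).card ≤ D) :
    ∃ n' ≤ n + L * L, GroupComputable N p K S B n' (held emb E fun _ => dst) := by
  have key : ∀ t ≤ L, ∃ n' ≤ n + t * L, ∃ loc' : (Fin N → Word p) → τ → Fin L → Fin k,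
      GroupComputable N p K S B n' (held emb E loc') ∧
      (∀ x v, (cube (E x) (loc' x) ∅ v).card ≤ D + k * L) ∧
      ∀ x e (j : Fin L), (j : ℕ) < t → loc' x e j = dst e j := by
    intro t
    induction t with
    | zero => exact fun _ => ⟨n, by simp, loc, h, fun x v => (hload x v).trans (by omega), by simp⟩
    | succ t ih =>
      intro ht
      obtain ⟨n₁, hn₁, loc₁, h₁, hload₁, hdst₁⟩ := ih (by omega)
      obtain ⟨n₂, hn₂, loc₂, h₂, hload₂, hdst₂⟩ := h₁.route_phase hemb hk hkK hB dst hS hload₁ hdst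
        ⟨t, ht⟩ (fun x e j hj => hdst₁ x e j hj)
      exact ⟨n₂, by rw [Nat.succ_mul]; omega, loc₂, h₂, hload₂,
        fun x e j hj => hdst₂ x e j (Fin.le_def.2 (Nat.lt_succ_iff.1 hj))⟩
  obtain ⟨n', hn', loc', h', -, hd⟩ := key L le_rfl
  refine ⟨n', hn', ?_⟩
  have : loc' = fun _ => dst := by
    funext x e j
    exact hd x e j j.2
  rwa [this] at h'

end route

/-! ### Simulation of protocols -/

open Classical in
/-- A family of lists of words as a set of packets: each packet consists of one word, the name of its
list, and its index in that list. -/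
noncomputable def packets {A W : Type} [Fintype A] [Fintype W] (s : ℕ) (ls : A → List W) :
    Finset (A × Fin s × W) :=
  Finset.univ.filter fun e => (ls e.1)[(e.2.1 : ℕ)]? = some e.2.2

theorem mem_packets {A W : Type} [Fintype A] [Fintype W] {s : ℕ} {ls : A → List W}
    {e : A × Fin s × W} : e ∈ packets s ls ↔ (ls e.1)[(e.2.1 : ℕ)]? = some e.2.2 := by
  simp [packets]

/-- The packets of the lists `ls x a`, where list `a` is stored at node `home a` of the cube. -/
noncomputable def placed {N p L k : ℕ} {A : Type} [Fintype A] (s : ℕ)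
    (emb : (Fin L → Fin k) → Fin N) (ls : (Fin N → Word p) → A → List (Word p))
    (home : A → Fin L → Fin k) : (Fin N → Word p) → Fin N → Finset (A × Fin s × Word p) :=
  held emb (fun x => packets s (ls x)) fun _ e => home e.1

section placed

variable {N p K S B n L k s : ℕ} {A A' : Type} [Fintype A] [Fintype A']
  {emb : (Fin L → Fin k) → Fin N} {ls : (Fin N → Word p) → A → List (Word p)}
  {home : A → Fin L → Fin k}

theorem card_cube_packets_le {W : Type} [Fintype W] (ls : A → List W) (home : A → Fin L → Fin k)
    (v : Fin L → Fin k) : (cube (packets s ls) (fun e => home e.1) ∅ v).card ≤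
      ∑ a with home a = v, (ls a).length := by
  classical
  rw [Finset.card_eq_sum_card_fiberwise (f := Prod.fst) (t := Finset.univ.filter (home · = v))
    (fun e he => by simpa using (mem_cube_empty.1 he).2)]
  refine Finset.sum_le_sum fun a _ => ?_
  rw [← Finset.card_range (ls a).length]
  refine Finset.card_le_card_of_injOn (fun e => e.2.1) (fun e he => ?_) ?_
  · obtain ⟨he', rfl⟩ := Finset.mem_filter.1 he
    simpa using (List.getElem?_eq_some_iff.1 (mem_packets.1 (mem_cube_empty.1 he').1)).1
  · rintro ⟨a₁, i₁, w₁⟩ he₁ ⟨a₂, i₂, w₂⟩ he₂ h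
    obtain ⟨he₁', rfl⟩ := Finset.mem_filter.1 he₁
    obtain ⟨he₂', h₂⟩ := Finset.mem_filter.1 he₂
    obtain rfl : i₁ = i₂ := Fin.ext h
    simp only at h₂
    subst h₂
    have h₁ := mem_packets.1 (mem_cube_empty.1 he₁').1
    have h₂ := mem_packets.1 (mem_cube_empty.1 he₂').1
    simp only at h₁ h₂
    rw [h₁] at h₂
    simpa using h₂

/-- The lists stored at a node can be recovered from its packets. -/
theorem eq_of_placed_eq (hemb : Function.Injective emb) (hlen : ∀ x a, (ls x a).length ≤ s)
    {x y : Fin N → Word p} {v : Fin L → Fin k}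
    (h : placed s emb ls home x (emb v) = placed s emb ls home y (emb v)) {a : A}
    (ha : home a = v) : ls x a = ls y a := by
  have key : ∀ i w, i < s → ((ls x a)[i]? = some w ↔ (ls y a)[i]? = some w) := by
    intro i w hi
    have := Finset.ext_iff.1 h (a, ⟨i, hi⟩, w)
    simpa [placed, held_emb hemb, mem_cube_empty, mem_packets, ha] using this
  refine List.ext_getElem? fun i => ?_
  by_cases hi : i < s
  · exact Option.ext fun w => key i w hi
  · rw [List.getElem?_eq_none ((hlen x a).trans (not_lt.1 hi)),
      List.getElem?_eq_none ((hlen y a).trans (not_lt.1 hi))]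

theorem placed_eq (hemb : Function.Injective emb) {x y : Fin N → Word p} {v : Fin L → Fin k}
    (h : ∀ a, home a = v → ls x a = ls y a) :
    placed s emb ls home x (emb v) = placed s emb ls home y (emb v) := by
  ext e
  simp only [placed, held_emb hemb, mem_cube_empty, mem_packets]
  constructor <;> rintro ⟨h1, h2⟩
  · exact ⟨by rw [← h _ h2]; exact h1, h2⟩
  · exact ⟨by rw [h _ h2]; exact h1, h2⟩

theorem fitsIn_placed (hemb : Function.Injective emb)
    (hB : Fintype.card (A × Fin s × Word p) < B)
    (hS : ∀ x v, ∑ a with home a = v, (ls x a).length ≤ S) :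
    FitsIn S B (placed s emb ls home) :=
  fitsIn_held hemb hB fun x v => (card_cube_packets_le (ls x) home v).trans (hS x v)

theorem GroupComputable.route_placed (hemb : Function.Injective emb) (hk : 0 < k)
    (hkK : k ≤ K) (hB : Fintype.card (A × Fin s × Word p) < B)
    (h : GroupComputable N p K S B n (placed s emb ls home)) {D : ℕ} (dst : A → Fin L → Fin k)
    (hS : D + 2 * (k * L) ≤ S) (hload : ∀ x v, ∑ a with home a = v, (ls x a).length ≤ D)
    (hdst : ∀ x v, ∑ a with dst a = v, (ls x a).length ≤ D) :
    ∃ n' ≤ n + L * L, GroupComputable N p K S B n' (placed s emb ls dst) :=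
  h.route hemb hk hkK hB (fun e => dst e.1) hS
    (fun x v => (card_cube_packets_le (ls x) home v).trans (hload x v))
    (fun x v => (card_cube_packets_le (ls x) dst v).trans (hdst x v))

/-- Nodes can replace the lists that they store by any functions of these lists. -/
theorem GroupComputable.map_placed (hemb : Function.Injective emb)
    (hB : Fintype.card (A' × Fin s × Word p) < B)
    (h : GroupComputable N p K S B n (placed s emb ls home)) (hlen : ∀ x a, (ls x a).length ≤ s)
    {ls' : (Fin N → Word p) → A' → List (Word p)} {home' : A' → Fin L → Fin k}
    (hls' : ∀ x y v, (∀ a, home a = v → ls x a = ls y a) → ∀ a, home' a = v → ls' x a = ls' y a)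
    (hS : ∀ x v, ∑ a with home' a = v, (ls' x a).length ≤ S) :
    GroupComputable N p K S B n (placed s emb ls' home') := by
  refine h.map _ (fun x y i hxy => ?_) (fitsIn_placed hemb hB hS)
  by_cases hi : ∃ v, emb v = i
  · obtain ⟨v, rfl⟩ := hi
    exact placed_eq hemb (hls' x y v fun a ha => eq_of_placed_eq hemb hlen hxy ha)
  · push Not at hi
    rw [placed, held_of_notMem_range hi, held_of_notMem_range hi]

end placed

theorem sum_filter_fst_le {ι ν : Type*} [Fintype ι] [DecidableEq ν] {g : ι → ν} {v : ν} {q D : ℕ}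
    (hg : (Finset.univ.filter (g · = v)).card ≤ q) (F : ι → ι → ℕ) (hF : ∀ i, ∑ k, F i k ≤ D) :
    ∑ a : ι × ι with g a.1 = v, F a.1 a.2 ≤ q * D := by
  rw [Finset.sum_filter, Fintype.sum_prod_type]
  calc ∑ i, ∑ k, (if g i = v then F i k else 0) = ∑ i with g i = v, ∑ k, F i k := by
        rw [Finset.sum_filter]
        refine Finset.sum_congr rfl fun i _ => ?_
        split_ifs <;> simp
    _ ≤ (Finset.univ.filter (g · = v)).card * D := Finset.sum_le_card_nsmul _ _ _ fun i _ => hF i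
    _ ≤ q * D := Nat.mul_le_mul_right _ hg

theorem sum_filter_snd_le {ι ν : Type*} [Fintype ι] [DecidableEq ν] {g : ι → ν} {v : ν} {q D : ℕ}
    (hg : (Finset.univ.filter (g · = v)).card ≤ q) (F : ι → ι → ℕ) (hF : ∀ k, ∑ i, F i k ≤ D) :
    ∑ a : ι × ι with g a.2 = v, F a.1 a.2 ≤ q * D := by
  refine le_trans (le_of_eq ?_) (sum_filter_fst_le hg (fun k i => F i k) hF)
  rw [Finset.sum_filter, Finset.sum_filter, Fintype.sum_prod_type, Fintype.sum_prod_type_right]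

theorem card_filter_comp_le {ι κ ν : Type*} [Fintype ι] [Fintype κ] [DecidableEq κ]
    [DecidableEq ν] {g : κ → ν} {f : ι → κ} {v : ν} {q s : ℕ}
    (hg : (Finset.univ.filter (g · = v)).card ≤ q)
    (hf : ∀ i, (Finset.univ.filter (f · = i)).card ≤ s) :
    (Finset.univ.filter (fun j => g (f j) = v)).card ≤ q * s := by
  rw [Finset.card_eq_sum_card_fiberwise (f := f) (t := Finset.univ.filter (g · = v))
    (fun j hj => by simpa using hj)]
  refine (Finset.sum_le_card_nsmul _ _ s fun i _ => ?_).trans (Nat.mul_le_mul_right _ hg)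
  exact (Finset.card_le_card (Finset.filter_subset_filter _ (Finset.subset_univ _))).trans (hf i)

namespace MPCProtocol

variable {N p P s R : ℕ} (π : MPCProtocol N p P s R)

theorem size_mem_le (x : Fin N → Word p) {t : ℕ} (ht : t ≤ R) (i : Fin P) :
    ∑ k, (π.mem x t i k).length ≤ s := by
  cases t with
  | zero =>
    refine le_trans (le_of_eq ?_) (π.inLoc_card i)
    rw [Finset.sum_eq_single_of_mem i (Finset.mem_univ _)]
    · simp only [MPCProgram.mem, if_true, List.length_map]
      rw [← List.toFinset_card_of_nodup ((List.nodup_finRange N).filter _)]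
      congr 1
      ext j
      simp
    · intro k _ hk
      simp [MPCProgram.mem, hk]
  | succ t => exact π.received_le x t ht i

theorem length_mem_le (x : Fin N → Word p) {t : ℕ} (ht : t ≤ R) (i k : Fin P) :
    (π.mem x t i k).length ≤ s :=
  (Finset.single_le_sum (f := fun k => (π.mem x t i k).length) (fun _ _ => Nat.zero_le _)
    (Finset.mem_univ k)).trans (π.size_mem_le x ht i)

/-- The data that a machine sends or keeps in a round have at most `2 * s` words. -/
theorem sum_length_sent_le (x : Fin N → Word p) {t : ℕ} (ht : t < R) (k : Fin P) :
    ∑ i, (π.mem x (t + 1) i k).length ≤ 2 * s := by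
  rw [← Finset.sum_erase_add _ _ (Finset.mem_univ k), two_mul]
  exact Nat.add_le_add (π.sent_le x t ht k) (π.length_mem_le x ht k k)

/-- A protocol can be executed by the nodes of a cube, among the tokens, which are the homes of the
machines (`g`) and of the input and output words (`f`). -/
theorem groupComputable {K S B L k q C : ℕ} {emb : (Fin L → Fin k) → Fin N}
    (hemb : Function.Injective emb) (hk : 0 < k) (hkK : k ≤ K) (hCK : C ≤ K) (hs : 0 < s)
    (f : Fin N → Fin L → Fin k) (hf : ∀ v, f (emb v) = v)
    (hfC : ∀ v, (Finset.univ.filter (f · = v)).card ≤ C)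
    (g : Fin P → Fin L → Fin k) (hg : ∀ v, (Finset.univ.filter (g · = v)).card ≤ q)
    (hB₁ : Fintype.card ((Fin P × Fin P) × Fin s × Word p) < B)
    (hB₂ : Fintype.card (Fin N × Fin s × Word p) < B) (hB₃ : 2 ^ p ≤ B) (hS₀ : 0 < S)
    (hS : q * (2 * s) + C + 2 * (k * L) ≤ S) :
    ∃ n ≤ 1 + (R + 2) * (L * L) + 1, GroupComputable N p K S B n π.output := by
  classical
  have hqs : q * s ≤ q * (2 * s) := Nat.mul_le_mul_left _ (by omega)
  -- Classes of the tokens with the same home serve to deliver inputs to and outputs from the nodes.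
  have hcl : ∀ c, (Finset.univ.filter (fun j => emb (f j) = c)).card ≤ K := by
    intro c
    by_cases hc : ∃ v, emb v = c
    · obtain ⟨v, rfl⟩ := hc
      simp only [hemb.eq_iff]
      exact (hfC v).trans hCK
    · rw [Finset.filter_eq_empty_iff.2 fun j _ hj => hc ⟨_, hj⟩]
      simp
  have hword : FitsIn S B fun (x : Fin N → Word p) j => x j :=
    ⟨fun w _ => w.val, fun w _ => (ZMod.val_lt w).trans_le hB₃, fun x y i h =>
      ZMod.val_injective _ (congrFun h ⟨0, hS₀⟩)⟩
  have hword' : FitsIn S B π.output :=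
    ⟨fun w _ => w.val, fun w _ => (ZMod.val_lt w).trans_le hB₃, fun x y i h =>
      ZMod.val_injective _ (congrFun h ⟨0, hS₀⟩)⟩
  have hsingle : ∀ (y : (Fin N → Word p) → Fin N → Word p) (h : Fin N → Fin L → Fin k) x v,
      ∑ j with h j = v, [y x j].length = (Finset.univ.filter (h · = v)).card := by simp
  have h₀ : GroupComputable N p K S B 1
      (placed s emb (fun (x : Fin N → Word p) j => [x j]) f) := by
    refine .step _ _ (fun j => emb (f j)) (.input (fun x j => x j) (fun _ _ _ h => h) hword) hcl
      (fun x y i hxy => ?_) (fitsIn_placed hemb hB₂ fun x v => ?_)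
    · by_cases hi : ∃ v, emb v = i
      · obtain ⟨v, rfl⟩ := hi
        exact placed_eq hemb fun j hj => by rw [hxy j (by rw [hj, hf])]
      · push Not at hi
        rw [placed, held_of_notMem_range hi, held_of_notMem_range hi]
    · rw [hsingle fun x => x]
      exact (hfC v).trans (by omega)
  obtain ⟨n₁, hn₁, h₁⟩ := h₀.route_placed hemb hk hkK hB₂ (fun j => g (π.inLoc j)) hS
    (fun x v => by
      rw [hsingle fun x => x]
      exact (hfC v).trans (by omega))
    (fun x v => by
      rw [hsingle fun x => x]
      exact (card_filter_comp_le (hg v) π.inLoc_card).trans (by omega))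
  have hrounds : ∀ t ≤ R, ∃ n ≤ 1 + (t + 1) * (L * L), GroupComputable N p K S B n
      (placed s emb (fun x (a : Fin P × Fin P) => π.mem x t a.1 a.2) fun a => g a.1) := by
    intro t
    induction t with
    | zero =>
      refine fun _ => ⟨n₁, by omega, h₁.map_placed hemb hB₁ (fun _ _ => hs)
        (fun x y v hxy a ha => ?_) fun x v => ?_⟩
      · simp only [MPCProgram.mem]
        split_ifs with hk
        · refine List.map_congr_left fun j hj => ?_
          have hj : π.inLoc j = a.1 := by simpa using hj
          simpa using hxy j (by rw [hj, ha])
        · rfl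
      · exact (sum_filter_fst_le (hg v) _ fun i => π.size_mem_le x (Nat.zero_le R) i).trans
          (by omega)
    | succ t ih =>
      intro ht
      obtain ⟨n, hn, h⟩ := ih (by omega)
      have hload : ∀ x v, ∑ a : Fin P × Fin P with g a.2 = v, (π.mem x (t + 1) a.1 a.2).length ≤
          q * (2 * s) := fun x v =>
        sum_filter_snd_le (hg v) (fun i k => (π.mem x (t + 1) i k).length)
          fun k => π.sum_length_sent_le x ht k
      have h' : GroupComputable N p K S B n
          (placed s emb (fun x (a : Fin P × Fin P) => π.mem x (t + 1) a.1 a.2) fun a => g a.2) := by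
        refine h.map_placed hemb hB₁ (fun x a => π.length_mem_le x (by omega) _ _)
          (fun x y v hxy a ha => ?_) fun x v => (hload x v).trans (by omega)
        have hmem : π.mem x t a.2 = π.mem y t a.2 := funext fun k => hxy (a.2, k) ha
        simp only [MPCProgram.mem, hmem]
      obtain ⟨n', hn', h''⟩ := h'.route_placed hemb hk hkK hB₁ (fun a => g a.1) hS
        (fun x v => (hload x v).trans (by omega))
        (fun x v => (sum_filter_fst_le (hg v) _ fun i => π.size_mem_le x ht i).trans (by omega))
      exact ⟨n', by linarith, h''⟩
  obtain ⟨n₂, hn₂, h₂⟩ := hrounds R le_rfl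
  have h₃ : GroupComputable N p K S B n₂
      (placed s emb (fun x j => [π.output x j]) fun j => g (π.outLoc j)) := by
    refine h₂.map_placed hemb hB₂ (fun x a => π.length_mem_le x le_rfl _ _)
      (fun x y v hxy j hj => ?_) fun x v => ?_
    · have hmem : π.mem x R (π.outLoc j) = π.mem y R (π.outLoc j) :=
        funext fun k => hxy (π.outLoc j, k) hj
      simp only [MPCProtocol.output, hmem]
    · rw [hsingle]
      exact (card_filter_comp_le (hg v) π.outLoc_card).trans (by omega)
  obtain ⟨n₄, hn₄, h₄⟩ := h₃.route_placed hemb hk hkK hB₂ f hS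
    (fun x v => by
      rw [hsingle]
      exact (card_filter_comp_le (hg v) π.outLoc_card).trans (by omega))
    (fun x v => by
      rw [hsingle]
      exact (hfC v).trans (by omega))
  refine ⟨n₄ + 1, by linarith, h₄.step _ _ (fun j => emb (f j)) hcl (fun x y i hxy => ?_) hword'⟩
  simpa using eq_of_placed_eq hemb (fun _ _ => hs) (hxy (emb (f i)) (by rw [hf]))
    (rfl : f i = f i)

end MPCProtocol

/-! ### Choice of the parameters -/

theorem exists_fin_map_card_le (P : ℕ) {M : ℕ} (hM : 0 < M) :
    ∃ g : Fin P → Fin M, (∀ j, (g j : ℕ) = j % M) ∧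
      ∀ r, (Finset.univ.filter (g · = r)).card ≤ P / M + 1 := by
  refine ⟨fun j => ⟨j % M, Nat.mod_lt _ hM⟩, fun _ => rfl, fun r => ?_⟩
  rw [← Finset.card_range (P / M + 1)]
  refine Finset.card_le_card_of_injOn (fun j => (j : ℕ) / M) (fun j _ => ?_) fun i hi j hj hij => ?_
  · simpa [Nat.lt_succ_iff] using Nat.div_le_div_right (c := M) j.2.le
  · have h : (i : ℕ) % M = j % M := by
      have hi := congrArg Fin.val (Finset.mem_filter.1 hi).2
      have hj := congrArg Fin.val (Finset.mem_filter.1 hj).2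
      exact hi.trans hj.symm
    exact Fin.ext (by rw [← Nat.div_add_mod (i : ℕ) M, h, show (i : ℕ) / M = j / M from hij,
      Nat.div_add_mod])

theorem exists_cube_map_card_le (P : ℕ) {k : ℕ} (hk : 0 < k) (L : ℕ) :
    ∃ g : Fin P → Fin L → Fin k, ∀ v, (Finset.univ.filter (g · = v)).card ≤ P / k ^ L + 1 := by
  obtain ⟨g, -, hg⟩ := exists_fin_map_card_le P (pow_pos hk L)
  refine ⟨fun j => finFunctionFinEquiv.symm (g j), fun v => ?_⟩
  simpa [Equiv.symm_apply_eq] using hg (finFunctionFinEquiv v)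

/-- A cube with `k ^ L ≤ N` nodes is embedded in the set of `N` tokens, with a retraction whose fibers
have almost equal sizes. -/
theorem exists_cube_embedding {N k L : ℕ} (hk : 0 < k) (hkN : k ^ L ≤ N) :
    ∃ (emb : (Fin L → Fin k) → Fin N) (f : Fin N → Fin L → Fin k), Function.Injective emb ∧
      (∀ v, f (emb v) = v) ∧ ∀ v, (Finset.univ.filter (f · = v)).card ≤ N / k ^ L + 1 := by
  obtain ⟨g, hmod, hg⟩ := exists_fin_map_card_le N (pow_pos hk L)
  have hleft : ∀ v : Fin L → Fin k, finFunctionFinEquiv.symm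
      (g (Fin.castLE hkN (finFunctionFinEquiv v))) = v := by
    intro v
    rw [Equiv.symm_apply_eq]
    exact Fin.ext ((hmod _).trans (Nat.mod_eq_of_lt (finFunctionFinEquiv v).2))
  refine ⟨fun v => Fin.castLE hkN (finFunctionFinEquiv v), fun j => finFunctionFinEquiv.symm (g j),
    Function.LeftInverse.injective (g := fun j => finFunctionFinEquiv.symm (g j)) hleft, hleft,
    fun v => ?_⟩
  simpa [Equiv.symm_apply_eq] using hg (finFunctionFinEquiv v)

/-- The integer part of the `L`-th root. -/
theorem exists_root {N L : ℕ} (hN : 0 < N) (hL : 0 < L) :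
    ∃ k : ℕ, 0 < k ∧ k ^ L ≤ N ∧ N ≤ 2 ^ L * k ^ L ∧ (k : ℝ) ≤ (N : ℝ) ^ (1 / (L : ℝ)) := by
  have hL' : (L : ℝ) ≠ 0 := by exact_mod_cast hL.ne'
  have hN' : (1 : ℝ) ≤ N := by exact_mod_cast hN
  have hroot : ((N : ℝ) ^ (1 / (L : ℝ))) ^ L = N := by
    rw [← Real.rpow_natCast, ← Real.rpow_mul (by linarith), one_div_mul_cancel hL', Real.rpow_one]
  have h1 : 1 ≤ (N : ℝ) ^ (1 / (L : ℝ)) := Real.one_le_rpow hN' (by positivity)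
  have hfl := Nat.floor_le (zero_le_one.trans h1)
  have hk : 0 < ⌊(N : ℝ) ^ (1 / (L : ℝ))⌋₊ := Nat.floor_pos.2 h1
  refine ⟨_, hk, ?_, ?_, hfl⟩
  · have := pow_le_pow_left₀ (Nat.cast_nonneg _) hfl L
    rw [hroot] at this
    exact_mod_cast this
  · have h2 : (N : ℝ) ^ (1 / (L : ℝ)) ≤ 2 * ⌊(N : ℝ) ^ (1 / (L : ℝ))⌋₊ := by
      have h3 := (Nat.lt_floor_add_one ((N : ℝ) ^ (1 / (L : ℝ)))).le
      have h4 : (1 : ℝ) ≤ ⌊(N : ℝ) ^ (1 / (L : ℝ))⌋₊ := by exact_mod_cast hk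
      linarith
    have := pow_le_pow_left₀ (zero_le_one.trans h1) h2 L
    rw [hroot, mul_pow] at this
    exact_mod_cast this

theorem MPCProtocol.memory_pos {N p P s R : ℕ} (π : MPCProtocol N p P s R) (hN : 0 < N) :
    0 < s := by
  rcases Nat.eq_zero_or_pos s with rfl | h
  · have := π.inLoc_lt ⟨0, hN⟩
    simp at this
  · exact h

/-- The simulation with explicit bounds, in terms of a natural number bound `κ` for the constants in
the size restrictions, and the dimension `L` of the cube. -/
theorem MPCProtocol.exists_transformer {N p P s R κ L : ℕ} (hN : 0 < N) (hL : 0 < L)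
    (hP : P ≤ κ * N) (hs : s ≤ κ * N) (π : MPCProtocol N p P s R) {c ℓ : ℝ} (hℓ : 1 ≤ ℓ) :
    ∃ (k d : ℕ) (T : ANNATransformer N d d 2 0 c ℓ), (k : ℝ) ≤ (N : ℝ) ^ (1 / (L : ℝ)) ∧
      d = 2 + (k + (2 ^ L + 1)) *
        ((κ * 2 ^ L + 1) * (2 * s) + (2 ^ L + 1) + 2 * (k * L)) ∧
      T.depth ≤ (R + 2) * (L * L) + 3 ∧
      T.Precision (4 * (κ + (Nat.log 2 N + 1)) + p + 3) ∧ T.IsEMA ∧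
      ∀ x, T.Outputs x (π.output x) := by
  obtain ⟨k, hk, hkN, hNk, hkr⟩ := exists_root hN hL
  obtain ⟨emb, f, hemb, hf, hfC⟩ := exists_cube_embedding hk hkN
  obtain ⟨g, hg⟩ := exists_cube_map_card_le P hk L
  have hfC' : N / k ^ L + 1 ≤ 2 ^ L + 1 :=
    Nat.add_le_add_right (Nat.div_le_of_le_mul (by rwa [mul_comm])) 1
  have hq : P / k ^ L + 1 ≤ κ * 2 ^ L + 1 := by
    refine Nat.add_le_add_right (Nat.div_le_of_le_mul (hP.trans ?_)) 1
    exact (Nat.mul_le_mul_left κ hNk).trans (le_of_eq (by ring))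
  have hs₀ := π.memory_pos hN
  let B := (P * P + N) * (s * 2 ^ p) + 2 ^ p + 1
  obtain ⟨n, hn, h⟩ := π.groupComputable (K := k + (2 ^ L + 1))
    (S := (κ * 2 ^ L + 1) * (2 * s) + (2 ^ L + 1) + 2 * (k * L)) (B := B) hemb hk
    (Nat.le_add_right _ _) (Nat.le_add_left _ _) hs₀ f hf (fun v => (hfC v).trans hfC') g
    (fun v => (hg v).trans hq)
    (by
      simp only [Fintype.card_prod, Fintype.card_fin, ZMod.card, B]
      rw [add_mul]
      linarith [Nat.zero_le (N * (s * 2 ^ p)), Nat.zero_le (2 ^ p)])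
    (by
      simp only [Fintype.card_prod, Fintype.card_fin, ZMod.card, B]
      rw [add_mul]
      linarith [Nat.zero_le (P * P * (s * 2 ^ p)), Nat.zero_le (2 ^ p)])
    (by simp only [B]; omega) (by positivity) le_rfl
  have hb : N * B + N ≤ 2 ^ (4 * (κ + (Nat.log 2 N + 1)) + p + 3) := by
    let t := 2 ^ (κ + (Nat.log 2 N + 1))
    have hNt : N ≤ 2 ^ (Nat.log 2 N + 1) := (Nat.lt_pow_succ_log_self one_lt_two N).le
    have hκ : κ * N ≤ t := by
      simp only [t, pow_add 2 κ]
      exact Nat.mul_le_mul Nat.lt_two_pow_self.le hNt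
    have hNt' : N ≤ t := hNt.trans (Nat.pow_le_pow_right two_pos (by omega))
    have ht : 1 ≤ t := hN.trans_le hNt'
    have hpp : 1 ≤ 2 ^ p := Nat.one_le_two_pow
    calc N * B + N ≤ t * ((t * t + t) * (t * 2 ^ p) + 2 ^ p + 1) + t := by
          simp only [B]
          gcongr
          · exact hP.trans hκ
          · exact hP.trans hκ
          · exact hs.trans hκ
      _ = t ^ 4 * 2 ^ p + t ^ 3 * 2 ^ p + t * 2 ^ p + t * 1 + t * 1 := by ring
      _ ≤ t ^ 4 * 2 ^ p + t ^ 4 * 2 ^ p + t ^ 4 * 2 ^ p + t ^ 4 * 2 ^ p + t ^ 4 * 2 ^ p := by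
          have h3 : t ^ 3 ≤ t ^ 4 := Nat.pow_le_pow_right ht (by norm_num)
          have h1 : t ≤ t ^ 4 := Nat.le_self_pow (by norm_num) t
          gcongr
      _ ≤ t ^ 4 * 2 ^ p * 2 ^ 3 := by
          have := Nat.zero_le (t ^ 4 * 2 ^ p)
          omega
      _ = _ := by
          simp only [t, ← pow_mul, ← pow_add]
          congr 1
          ring
  obtain ⟨T, hdepth, hprec, hema, hout⟩ := h.exists_transformer (c := c) hℓ (by positivity)
    (Nat.pow_le_pow_right two_pos (by omega)) hb
  exact ⟨k, _, T, hkr, rfl, by omega, hprec, hema, hout⟩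

/-- The exponents of the memory size, of the size of the communication classes and of the width of the
transformer fit together. -/
theorem width_le {ε ε' κ N s k L q C : ℝ} (hN : 1 ≤ N) (hεε' : ε < ε') (hε : 0 < ε)
    (hs : s ≤ κ * N ^ ε) (hk₀ : 0 ≤ k) (hk : k ≤ N ^ ((ε' - ε) / 2)) (hs₀ : 0 ≤ s) (hL : 0 ≤ L)
    (hq : 0 ≤ q) (hC : 0 ≤ C) (hκ : 0 ≤ κ) :
    2 + (k + C) * (q * (2 * s) + C + 2 * (k * L)) ≤
      (2 + (1 + C) * (q * (2 * κ) + C + 2 * L)) * N ^ ε' := by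
  set u := N ^ ((ε' - ε) / 2)
  set w := N ^ ε
  have hu : 1 ≤ u := Real.one_le_rpow hN (by linarith)
  have hw : 1 ≤ w := Real.one_le_rpow hN hε.le
  have huw : N ^ ε' = u * (u * w) := by
    simp only [u, w, ← Real.rpow_add (zero_lt_one.trans_le hN)]
    congr 1
    ring
  have huw' : 1 ≤ u * w := one_le_mul_of_one_le_of_one_le hu hw
  have h1 : k + C ≤ (1 + C) * u := by nlinarith
  have hs' : s ≤ κ * (u * w) := hs.trans (by gcongr; nlinarith)
  have hk' : k ≤ u * w := hk.trans (by nlinarith)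
  have h2 : q * (2 * s) + C + 2 * (k * L) ≤ (q * (2 * κ) + C + 2 * L) * (u * w) :=
    calc q * (2 * s) + C + 2 * (k * L)
        ≤ q * (2 * (κ * (u * w))) + C * (u * w) + 2 * (u * w * L) := by
          gcongr
          exact le_mul_of_one_le_right hC huw'
      _ = _ := by ring
  calc 2 + (k + C) * (q * (2 * s) + C + 2 * (k * L))
      ≤ 2 * (u * (u * w)) + (1 + C) * u * ((q * (2 * κ) + C + 2 * L) * (u * w)) := by
        gcongr
        nlinarith
    _ = _ := by rw [huw]; ring

theorem theorem4p1 (ε ε' κ : ℝ) (hε : 0 < ε) (hεε' : ε < ε') (hε' : ε' < 1) :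
    ∃ C : ℝ, ∀ (N p P s R : ℕ), 0 < N → 0 < R → MPCSizes ε ε κ N p P s →
      ∀ π : MPCProtocol N p P s R, ∀ c ℓ : ℝ, 1 < c → 1 ≤ ℓ →
        ∃ (d m H b : ℕ) (T : ANNATransformer N d m H 0 c ℓ),
          (T.depth : ℝ) ≤ C * R ∧
          (H : ℝ) ≤ C * (N : ℝ) ^ ((ε' - ε) / 4) ∧
          (m : ℝ) ≤ C * (N : ℝ) ^ ε' ∧
          (d : ℝ) ≤ C * (N : ℝ) ^ ε' ∧
          (b : ℝ) ≤ C * Real.log N ∧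
          T.Precision b ∧
          T.IsEMA ∧
          ∀ x : Fin N → Word p, T.Outputs x (π.output x) := by
  let L := ⌈2 / (ε' - ε)⌉₊
  let κ' := ⌈κ⌉₊
  have hδ : 0 < ε' - ε := by linarith
  have hL : 0 < L := Nat.ceil_pos.2 (by positivity)
  have hLδ : 1 / (L : ℝ) ≤ (ε' - ε) / 2 := by
    rw [one_div_le (by exact_mod_cast hL) (by positivity), one_div_div]
    exact Nat.le_ceil _
  have hκ' : κ ≤ κ' := Nat.le_ceil κ
  let q : ℝ := κ' * 2 ^ L + 1
  let C₀ : ℝ := 2 ^ L + 1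
  let Cd : ℝ := 2 + (1 + C₀) * (q * (2 * κ') + C₀ + 2 * L)
  have hCd : 2 ≤ Cd := le_add_of_nonneg_right (by positivity)
  refine ⟨(3 * (L * L) + 3) + Cd + (9 * κ' + 22),
    fun N p P s R hN hR hsz π c ℓ _ hℓ => ?_⟩
  set C : ℝ := (3 * (L * L) + 3) + Cd + (9 * κ' + 22)
  have hN' : (1 : ℝ) ≤ N := by exact_mod_cast hN
  have hR' : (1 : ℝ) ≤ R := by exact_mod_cast hR
  have hC1 : 3 * (L * L) + 3 ≤ C := by
    have : (0 : ℝ) ≤ 9 * κ' + 22 := by positivity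
    simp only [C]
    linarith
  have hC2 : Cd ≤ C := by
    have : (0 : ℝ) ≤ (3 * (L * L) + 3) + (9 * κ' + 22) := by positivity
    simp only [C]
    linarith
  have hC3 : 9 * κ' + 22 ≤ C := by
    have : (0 : ℝ) ≤ 3 * (L * L) + 3 := by positivity
    simp only [C]
    linarith
  have hC0 : 0 ≤ C := by linarith
  have hCpow : ∀ (a : ℝ) (e : ℝ), 0 ≤ e → a ≤ C → a ≤ C * (N : ℝ) ^ e := fun a e he ha =>
    ha.trans (le_mul_of_one_le_right hC0 (Real.one_le_rpow hN' he))
  have hlog : 0 ≤ Real.log N := Real.log_nonneg hN'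
  have hp : (p : ℝ) ≤ κ' * Real.log N :=
    hsz.word_le.trans (mul_le_mul_of_nonneg_right hκ' hlog)
  rcases Nat.eq_or_lt_of_le hN with rfl | hN2
  -- For `N = 1` the precision has to be `0`; but then words have no bits, and the output is trivial.
  · obtain rfl : p = 0 := by
      have : (p : ℝ) ≤ 0 := by simpa using hp
      exact_mod_cast this.antisymm (Nat.cast_nonneg p)
    have h0 : IsFixedPoint 0 0 := by simpa using IsFixedPoint.natCast (b := 0) (n := 0) (by simp)
    refine ⟨1, 0, 0, 0, ⟨[], fun _ _ => 0⟩, by simp [ANNATransformer.depth]; positivity,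
      by simpa using hC0, by simpa using hC0, by simpa using by linarith, by simp,
      ⟨by simp, by simp, by simp, by simp, fun _ => rfl, fun _ _ => h0⟩,
      by simp [ANNATransformer.IsEMA], fun x => ⟨one_pos, fun i => ?_⟩⟩
    have hw : ∀ w : Word 0, w.val = 0 := fun w => by
      have := ZMod.val_lt w
      omega
    simp [ANNATransformer.eval, hw]
  · have hP : P ≤ κ' * N := by
      have h := hsz.machines_le
      rw [add_sub_cancel_right, Real.rpow_one] at h
      exact_mod_cast h.trans (mul_le_mul_of_nonneg_right hκ' (by linarith))
    have hs : (s : ℝ) ≤ κ' * (N : ℝ) ^ ε :=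
      hsz.memory_le.trans (mul_le_mul_of_nonneg_right hκ' (by positivity))
    have hs' : s ≤ κ' * N := by
      have h : (N : ℝ) ^ ε ≤ (N : ℝ) ^ (1 : ℝ) := Real.rpow_le_rpow_of_exponent_le hN' (by linarith)
      rw [Real.rpow_one] at h
      exact_mod_cast hs.trans (mul_le_mul_of_nonneg_left h (Nat.cast_nonneg _))
    obtain ⟨k, d, T, hk, hd, hdepth, hprec, hema, hout⟩ :=
      π.exists_transformer (c := c) hN hL hP hs' hℓ
    have hdle : (d : ℝ) ≤ C * (N : ℝ) ^ ε' := by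
      have h := width_le (k := k) (L := L) (q := q) (C := C₀) hN' hεε' hε hs (Nat.cast_nonneg k)
        (hk.trans (Real.rpow_le_rpow_of_exponent_le hN' hLδ)) (Nat.cast_nonneg s)
        (Nat.cast_nonneg L) (by positivity) (by positivity) (Nat.cast_nonneg κ')
      rw [hd]
      push_cast
      exact h.trans (mul_le_mul_of_nonneg_right hC2 (by positivity))
    refine ⟨d, d, 2, _, T, ?_, ?_, hdle, hdle, ?_, hprec, hema, hout⟩
    · have h1 : (T.depth : ℝ) ≤ (R + 2) * (L * L) + 3 := by exact_mod_cast hdepth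
      have h2 : (0 : ℝ) ≤ L * L := by positivity
      calc (T.depth : ℝ) ≤ (R + 2) * (L * L) + 3 := h1
        _ ≤ (R + 2 * R) * (L * L) + 3 * R := by gcongr <;> linarith
        _ = (3 * (L * L) + 3) * R := by ring
        _ ≤ C * R := by gcongr
    · exact_mod_cast hCpow 2 _ (by linarith) (by linarith)
    · have hlog2 : 1 / 2 ≤ Real.log 2 := by linarith [Real.log_two_gt_d9]
      have h1 : 1 ≤ 2 * Real.log N := by
        have : Real.log 2 ≤ Real.log N := Real.log_le_log two_pos (by exact_mod_cast hN2)
        linarith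
      have h2 : (Nat.log 2 N : ℝ) ≤ 2 * Real.log N := by
        have h : ((2 ^ Nat.log 2 N : ℕ) : ℝ) ≤ N := by
          exact_mod_cast Nat.pow_log_le_self 2 hN.ne'
        have h := Real.log_le_log (by positivity) h
        rw [Nat.cast_pow, Real.log_pow, Nat.cast_ofNat] at h
        nlinarith [Nat.cast_nonneg (α := ℝ) (Nat.log 2 N)]
      calc ((4 * (κ' + (Nat.log 2 N + 1)) + p + 3 : ℕ) : ℝ)
          = (4 * κ' + 7) * 1 + 4 * Nat.log 2 N + p := by
            push_cast
            ring
        _ ≤ (4 * κ' + 7) * (2 * Real.log N) + 4 * (2 * Real.log N) + κ' * Real.log N := by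
            gcongr
        _ = (9 * κ' + 22) * Real.log N := by ring
        _ ≤ C * Real.log N := by gcongr
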